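/- **Setting.** Let $x\in\{1,2\}$ denote inputs and $a\in\{+1,-1\}$ outputs. Vectors such as $\vec E=(E_1,E_2)$, $\vec\omega=(\omega_1,\omega_2)$ lie in $\mathbb R^2$, and inequalities between vectors are componentwise. A behaviour $(\vec E,\vec\omega)\in\mathbb R^4$ is *realisable* if on some Hilbert space there are density operators $\rho_1,\rho_2$, an observable $-1\le M\le 1$ and an observable $O$ with an orthonormal eigenbasis, with non-degenerate lowest eigenvalue $0$ and all other eigenvalues at least $1$, such that $\mathrm{Tr}[\rho_xM]=E_x$ and $\mathrm{Tr}[\rho_xO]\le\omega_x$ for $x=1,2$. Let $\mathcal Q$ be the convex hull of the set of realisable behaviours. **Device.** Let $n\ge 1$, let $p(1),p(2)>0$ with $p(1)+p(2)=1$, let $\vec 0\le\vec\omega_{\rm avg}\le\vec\omega_{\rm pk}\le\vec 1$ and $\epsilon_\omega\ge 0$. Let $\mu$ be a distribution of $(A^n,X^n,\Lambda)$ with $A_i\in\{\pm1\}$, $X_i\in\{1,2\}$ and $\Lambda$ a discrete random variable. Write $W_i=(A^{i-1},X^{i-1})$ and assume that for each $i$ there are functions $\vec E_i,\vec\omega_i$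 of $(W_i,\Lambda)$ with values satisfying $(\vec E_i(W_i,\Lambda),\vec\omega_i(W_i,\Lambda))\in\mathcal Q$ and $\vec\omega_i(W_i,\Lambda)\le\vec\omega_{\rm pk}$, such that $\mu(X_i=x\mid W_i,\Lambda)=p(x)$, $\mu(A_i=a\mid X_i=x,W_i,\Lambda)=\frac12\big(1+aE_{x,i}(W_i,\Lambda)\big)$, and $$\Pr\Big(\tfrac1n\sum_{i=1}^n\vec\omega_i(W_i,\Lambda)\le\vec\omega_{\rm avg}\Big)\ge 1-\epsilon_\omega .$$ **Test.** Let $(\vec\alpha,\vec\beta,\vec\gamma)\in(\mathbb R^2)^3$ be a trade-off function, that is, $\vec\gamma\le 0$ and $\alpha_1+\alpha_2+\vec\beta\cdot\vec E+\vec\gamma\cdot\vec\omega\le H(\vec E)$ for all $(\vec E,\vec\omega)\in\mathcal Q$ with $\vec\omega\le\vec\omega_{\rm pk}$, where $H(\vec E)=-\sum_{a,x}p(x)\frac{1+aE_x}{2}\log_2\frac{1+aE_x}{2}$. Put $\xi(a,x)=\frac{\alpha_x+a\beta_x}{p(x)}$, $\xi^+=\max_{a,x}\xi(a,x)$, $\xi^-=\min_{a,x}\xi(a,x)$,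 $\bar\gamma=\gamma_1+\gamma_2$, and assume $\xi^+\ge 0$. Let $0<\epsilon_t\le1$, $0<\epsilon_m\le 1$ and, with $|A|=2$, $$V=\max\{(\xi^++\bar\gamma)^2,(\xi^-+\bar\gamma)^2\}+2\max\{-\log_2|A|\,(\bar\gamma+\xi^-),0\}+\tfrac{4|A|}{e^2}(\log_2 e)^2,$$ $$t=\sqrt{2V}\sqrt{\tfrac{\log_2(1/\epsilon_t)}{n}}+\tfrac{\xi^+}{3}\,\tfrac{\log_2(1/\epsilon_t)}{n}.$$ Let $r\in\mathbb R$ with $r-t\le1$, let $\mathrm{Pass}$ be the event $\frac1n\sum_i\xi(A_i,X_i)+\vec\gamma\cdot\vec\omega_{\rm avg}\ge r$, suppose $\kappa=\Pr(\mathrm{Pass})>0$, and let $\mu_{\rm Pass}$ be $\mu$ conditioned on $\mathrm{Pass}$. **Entropies.** For a discrete distribution $\mu'$ of $(A,Z)$, $H^{\epsilon}_{\min,\mu'}(A|Z)$ is the largest $k$ for which there is a distribution $\nu$ of $(A,Z)$ with the same marginal on $Z$ as $\mu'$, with $\frac12\sum_{a,z}|\nu(a,z)-\mu'(a,z)|\le\epsilon$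 and with $-\log_2\mathbb E\big[\max_a\nu(a|Z)\big]\ge k$; and $H^{u,\epsilon}_{\min,\mu'}(A|Z)$ is defined in the same way with the last condition replaced by $-\log_2\nu(a|z)\ge k$ for all $a,z$. **Proposition.** Then $$H^{(\epsilon_\omega+\epsilon_t)/\kappa}_{\min,\mu_{\rm Pass}}(A^n|X^n\Lambda)\ \ge\ n(r-t)-\log_2\tfrac1\kappa ,$$ $$H^{u,(\epsilon_\omega+\epsilon_t+\epsilon_m)/\kappa}_{\min,\mu_{\rm Pass}}(A^n|X^n\Lambda)\ \ge\ n(r-t)-\log_2\tfrac1{\epsilon_m}\ =\ \sigma_h ,$$ where $\sigma_h=n\Big(r-\sqrt{2V}\sqrt{\tfrac{\log_2(1/\epsilon_t)}{n}}-\tfrac{\xi^+}{3}\tfrac{\log_2(1/\epsilon_t)}{n}-\tfrac{\log_2(1/\epsilon_m)}{n}\Big)$; in both cases the right-hand side is itself attained by some $\nu$ as in the definition. -/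

import Mathlib

open scoped ENNReal

noncomputable section

namespace SemiDI

/-! ### Outputs, inputs and the quantum set -/

/-- The outputs `a ∈ {+1, -1}`. -/
abbrev Output : Type := ℤˣ

/-- The two inputs (the indices `0, 1` stand for `x = 1, 2`). -/
abbrev Input : Type := Fin 2

/-- The real number `+1` or `-1` attached to an output. -/
def outVal (a : Output) : ℝ := ((a : ℤ) : ℝ)

section Quantum

variable {H : Type} [NormedAddCommGroup H] [InnerProductSpace ℂ H]

/-- `Tr T = c`, computed in the Hilbert basis `b`. -/
def HasTrace {ι : Type} (b : HilbertBasis ι ℂ H) (T : H →L[ℂ] H) (c : ℂ) : Prop :=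
  HasSum (fun i => inner ℂ (b i) (T (b i))) c

/-- An energy observable `O = ∑ i, eigenvalue i • |b i⟩⟨b i|`, given by its spectral
decomposition (so that unbounded observables such as a number operator are allowed):
the eigenvalue `0` occurs exactly once, at the vacuum, and all others are at least `1`. -/
structure EnergyObservable (H : Type) [NormedAddCommGroup H] [InnerProductSpace ℂ H] where
  ι : Type
  basis : HilbertBasis ι ℂ H
  eigenvalue : ι → ℝ
  vacuum : ι
  eigenvalue_vacuum : eigenvalue vacuum = 0
  one_le_eigenvalue : ∀ i, i ≠ vacuum → 1 ≤ eigenvalue i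

/-- `Tr [ρ O] ≤ w` for a positive operator `ρ`; in the eigenbasis of `O` the trace is the series
of non-negative terms `eigenvalue i * ⟨b i, ρ (b i)⟩`, and it has to be finite. -/
def EnergyObservable.MeanLE (O : EnergyObservable H) (ρ : H →L[ℂ] H) (w : ℝ) : Prop :=
  ∃ e : ℝ, HasSum
    (fun i => O.eigenvalue i * (inner ℂ (O.basis i) (ρ (O.basis i))).re) e ∧ e ≤ w

end Quantum

/-- A behaviour `(E, ω)`: two correlations and two energy bounds. -/
abbrev Behaviour : Type := (Input → ℝ) × (Input → ℝ)

/-- Behaviours realised by two states `ρ x`, an observable `-1 ≤ M ≤ 1` and an energy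
observable `O` on some Hilbert space, through `Tr [ρ x M] = E x` and `Tr [ρ x O] ≤ ω x`. -/
def IsRealisable (q : Behaviour) : Prop :=
  ∃ (H : Type) (_ : NormedAddCommGroup H) (_ : InnerProductSpace ℂ H) (_ : CompleteSpace H)
    (O : EnergyObservable H) (ρ : Input → H →L[ℂ] H) (M : H →L[ℂ] H),
    (∀ x, (ρ x).IsPositive ∧ HasTrace O.basis (ρ x) 1) ∧
    ((1 : H →L[ℂ] H) - M).IsPositive ∧ ((1 : H →L[ℂ] H) + M).IsPositive ∧
    (∀ x, HasTrace O.basis (ρ x ∘L M) (q.1 x : ℂ)) ∧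
    (∀ x, O.MeanLE (ρ x) (q.2 x))

/-- The quantum set `𝒬`: convex combinations of realisable behaviours. -/
def quantumSet : Set Behaviour := convexHull ℝ {q | IsRealisable q}

/-! ### Discrete probability -/

/-- Probability of an event under a discrete distribution. -/
def prob {Ω : Type*} (μ : PMF Ω) (S : Set Ω) : ℝ := (μ.toOuterMeasure S).toReal

theorem exists_mem_support_of_prob_pos {Ω : Type*} {μ : PMF Ω} {S : Set Ω}
    (h : 0 < prob μ S) : ∃ w ∈ S, w ∈ μ.support := by
  by_contra hc
  have hd : Disjoint μ.support S := by
    rw [Set.disjoint_left]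
    intro w hw hS
    exact hc ⟨w, hS, hw⟩
  have h0 : μ.toOuterMeasure S = 0 := (PMF.toOuterMeasure_apply_eq_zero_iff μ S).2 hd
  simp [prob, h0] at h

/-- The distribution `μ` conditioned on an event of positive probability. -/
def condOn {Ω : Type*} (μ : PMF Ω) (S : Set Ω) (h : 0 < prob μ S) : PMF Ω :=
  μ.filter S (exists_mem_support_of_prob_pos h)

/-- Total variation distance `½ ∑ |μ - ν|`. -/
def tvDist {Ω : Type*} (μ ν : PMF Ω) : ℝ := (1 / 2) * ∑' w, |(μ w).toReal - (ν w).toReal|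

/-- The marginal distribution of `Z` under a distribution of `AZ`. -/
def marginalZ {A Z : Type*} (ν : PMF (A × Z)) : PMF Z := ν.map Prod.snd

/-- The conditional probability `ν(a|z)` (it is `0` where `ν(z) = 0`). -/
def condProb {A Z : Type*} (ν : PMF (A × Z)) (a : A) (z : Z) : ℝ≥0∞ := ν (a, z) / marginalZ ν z

/-- The numbers `k` for which some `ν` with the same marginal of `Z` as `μ` and
`TV(ν, μ) ≤ ε` has `-log₂ 𝔼[max_a ν(a|Z)] ≥ k`, that is, `𝔼[max_a ν(a|Z)] ≤ 2 ^ (-k)`. -/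
def avgAchievable {A Z : Type*} (ε : ℝ) (μ : PMF (A × Z)) : Set ℝ :=
  {k | ∃ ν : PMF (A × Z), marginalZ ν = marginalZ μ ∧ tvDist ν μ ≤ ε ∧
    (∑' z, marginalZ ν z * (⨆ a, condProb ν a z)) ≤ ENNReal.ofReal ((2 : ℝ) ^ (-k))}

/-- The numbers `k` for which some `ν` with the same marginal of `Z` as `μ` and
`TV(ν, μ) ≤ ε` has `-log₂ ν(a|z) ≥ k`, that is, `ν(a|z) ≤ 2 ^ (-k)`, for all `a` and `z`. -/
def worstAchievable {A Z : Type*} (ε : ℝ) (μ : PMF (A × Z)) : Set ℝ :=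
  {k | ∃ ν : PMF (A × Z), marginalZ ν = marginalZ μ ∧ tvDist ν μ ≤ ε ∧
    ∀ a z, condProb ν a z ≤ ENNReal.ofReal ((2 : ℝ) ^ (-k))}

/-- Smooth average conditional min-entropy `H_min^ε(A|Z)`. -/
def smoothAvgMinEntropy {A Z : Type*} (ε : ℝ) (μ : PMF (A × Z)) : EReal :=
  sSup ((fun k : ℝ => (k : EReal)) '' avgAchievable ε μ)

/-- Smooth worst-case conditional min-entropy `H_min^{u,ε}(A|Z)`. -/
def smoothWorstMinEntropy {A Z : Type*} (ε : ℝ) (μ : PMF (A × Z)) : EReal :=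
  sSup ((fun k : ℝ => (k : EReal)) '' worstAchievable ε μ)

/-! ### The multi-round device -/

/-- Values of `(Aⁿ, (Xⁿ, Λ))`. -/
abbrev Outcome (n : ℕ) (L : Type*) : Type _ := (Fin n → Output) × ((Fin n → Input) × L)

/-- Values of the past `W_i = (A^{i-1}, X^{i-1})` before the round with (zero-based) index `i`. -/
abbrev History (i : ℕ) : Type := (Fin i → Output) × (Fin i → Input)

/-- The past of round `i` in a full run. -/
def past {n : ℕ} {L : Type*} (i : Fin n) (w : Outcome n L) : History i :=
  (fun j => w.1 (Fin.castLE i.isLt.le j), fun j => w.2.1 (Fin.castLE i.isLt.le j))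

/-- The event `W_i = h, Λ = l`. -/
def pastEvent {n : ℕ} {L : Type*} (i : Fin n) (h : History i) (l : L) : Set (Outcome n L) :=
  {w | past i w = h ∧ w.2.2 = l}

/-- The assumptions on the distribution `μ` of `AⁿXⁿΛ`, for a device with behaviour
`(corr i W_i Λ, energy i W_i Λ)` in round `i`. The conditional probabilities are written
in product form, so that they are only constrained where the condition has positive probability. -/
structure DeviceAssumptions {n : ℕ} {L : Type*} (μ : PMF (Outcome n L)) (p : Input → ℝ)
    (ωpk ωavg : Input → ℝ) (εω : ℝ)
    (corr energy : (i : Fin n) → History i → L → Input → ℝ) : Prop where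
  /-- `μ(X_i = x | W_i Λ) = p(x)` -/
  input : ∀ (i : Fin n) (h : History i) (l : L) (x : Input),
    prob μ (pastEvent i h l ∩ {w | w.2.1 i = x}) = p x * prob μ (pastEvent i h l)
  /-- `(E_i(W_i,Λ), ω_i(W_i,Λ)) ∈ 𝒬` -/
  quantum : ∀ (i : Fin n) (h : History i) (l : L), (corr i h l, energy i h l) ∈ quantumSet
  /-- `μ(A_i = a | X_i = x, W_i Λ) = (1 + a E_{x,i}(W_i,Λ)) / 2` -/
  output : ∀ (i : Fin n) (h : History i) (l : L) (x : Input) (a : Output),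
    prob μ (pastEvent i h l ∩ {w | w.2.1 i = x} ∩ {w | w.1 i = a}) =
      (1 + outVal a * corr i h l x) / 2 * prob μ (pastEvent i h l ∩ {w | w.2.1 i = x})
  /-- max-peak assumption -/
  maxPeak : ∀ (i : Fin n) (h : History i) (l : L) (x : Input), energy i h l x ≤ ωpk x
  /-- max-average assumption -/
  maxAverage : 1 - εω ≤
    prob μ {w | ∀ x, (1 / (n : ℝ)) * ∑ i, energy i (past i w) w.2.2 x ≤ ωavg x}

/-! ### Trade-off functions and the protocol -/

/-- `H(E) = -∑_{a,x} p(x) (1 + a E_x)/2 log₂ ((1 + a E_x)/2)`. -/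
def condEntropy (p E : Input → ℝ) : ℝ :=
  -∑ a : Output, ∑ x : Input,
    p x * ((1 + outVal a * E x) / 2) * Real.logb 2 ((1 + outVal a * E x) / 2)

/-- Trade-off functions with max-peak energies `ωpk`. -/
def IsTradeOff (p ωpk α β γ : Input → ℝ) : Prop :=
  (∀ x, γ x ≤ 0) ∧
  ∀ E ω : Input → ℝ, (E, ω) ∈ quantumSet → (∀ x, ω x ≤ ωpk x) →
    ∑ x, α x + ∑ x, β x * E x + ∑ x, γ x * ω x ≤ condEntropy p E

/-- The arguments of the protocol (other than the number of rounds and the extractor). -/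
structure ProtocolArgs where
  /-- input distribution -/
  p : Input → ℝ
  /-- peak energy thresholds -/
  ωpk : Input → ℝ
  /-- average energy thresholds -/
  ωavg : Input → ℝ
  εω : ℝ
  εt : ℝ
  εm : ℝ
  α : Input → ℝ
  β : Input → ℝ
  γ : Input → ℝ
  /-- threshold of the test -/
  r : ℝ

namespace ProtocolArgs

variable (P : ProtocolArgs)

/-- The estimator `ξ(a,x) = (α_x + a β_x) / p(x)`. -/
def xi (a : Output) (x : Input) : ℝ := (1 / P.p x) * (P.α x + outVal a * P.β x)

/-- `ξ⁺ = max_{a,x} ξ(a,x)`. -/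
def xiMax : ℝ :=
  (Finset.univ : Finset (Output × Input)).sup' Finset.univ_nonempty fun q => P.xi q.1 q.2

/-- `ξ⁻ = min_{a,x} ξ(a,x)`. -/
def xiMin : ℝ :=
  (Finset.univ : Finset (Output × Input)).inf' Finset.univ_nonempty fun q => P.xi q.1 q.2

/-- `γ̄ = ∑ x, γ_x`. -/
def gammaBar : ℝ := ∑ x, P.γ x

/-- The second-moment bound `V`. -/
def V : ℝ :=
  max ((P.xiMax + P.gammaBar) ^ 2) ((P.xiMin + P.gammaBar) ^ 2)
    + 2 * max (-(Real.logb 2 (Fintype.card Output) * (P.gammaBar + P.xiMin))) 0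
    + 4 * (Fintype.card Output : ℝ) / Real.exp 1 ^ 2 * Real.logb 2 (Real.exp 1) ^ 2

/-- The error term `t`. -/
def t (n : ℕ) : ℝ :=
  √(2 * P.V) * √(Real.logb 2 (1 / P.εt) / n) + P.xiMax / 3 * (Real.logb 2 (1 / P.εt) / n)

/-- The min-entropy `σ_h` for which the extractor of the protocol is chosen. -/
def sigmaH (n : ℕ) : ℝ :=
  n * (P.r - √(2 * P.V) * √(Real.logb 2 (1 / P.εt) / n)
    - P.xiMax / 3 * (Real.logb 2 (1 / P.εt) / n) - Real.logb 2 (1 / P.εm) / n)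

/-- Validity of the arguments for `n` rounds. -/
structure Valid (n : ℕ) : Prop where
  rounds_pos : 1 ≤ n
  p_pos : ∀ x, 0 < P.p x
  p_sum : ∑ x, P.p x = 1
  ωavg_nonneg : ∀ x, 0 ≤ P.ωavg x
  ωavg_le_ωpk : ∀ x, P.ωavg x ≤ P.ωpk x
  ωpk_le_one : ∀ x, P.ωpk x ≤ 1
  εω_nonneg : 0 ≤ P.εω
  εt_pos : 0 < P.εt
  εt_le_one : P.εt ≤ 1
  εm_pos : 0 < P.εm
  εm_le_one : P.εm ≤ 1
  tradeOff : IsTradeOff P.p P.ωpk P.α P.β P.γ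
  xiMax_nonneg : 0 ≤ P.xiMax
  r_sub_t_le_one : P.r - P.t n ≤ 1

/-- The event that the test `⟨ξ⟩ + γ · ω_avg ≥ r` is passed. -/
def passEvent (n : ℕ) (L : Type*) : Set (Outcome n L) :=
  {w | P.r ≤ (1 / (n : ℝ)) * ∑ i, P.xi (w.1 i) (w.2.1 i) + ∑ x, P.γ x * P.ωavg x}

end ProtocolArgs

end SemiDI

end

noncomputable section

namespace SemiDI

/-! ### Elementary inequalities -/

/-! Follow the increment `D_i = ξ(A_i,X_i) + γ·ω_i + log₂ P(A_i|X_i,W_i,Λ)` of each round. Given the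
past, its mean is the trade-off expression minus `H(E_i)`, hence at most zero. It is at most `ξ⁺`,
because `γ ≤ 0`, energies are nonnegative and logarithms of probabilities are nonpositive; its
second moment is at most `V`. Multiplying conditional exponential moments round by round gives a
one-sided Bernstein inequality (`prob_lt_totalIncrement_le`): the increments sum to at most `n t`
except with probability `ε_t`.

Since inputs are independent of the past, `μ(Aⁿ|Xⁿ,Λ)` is the product of the round probabilities. On
runs that pass, have average energies at most `ω_avg` and a sum of increments at most `n t`, this
product is therefore at most `2^{-n(r-t)}` (`apply_le_of_mem_goodEvent`). The other passing runs
have mass at most `ε_ω + ε_t`, and conditioning divides by `κ`.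

Smoothing (`exists_smoothing`) spreads the bad mass, separately for each `z`, below a ceiling
`c(z)`; `r - t ≤ 1` guarantees enough room. The ceiling `μ(z) 2^{-n(r-t)}/κ` gives the average
entropy after summing over `z`. The worst-case entropy needs a ceiling proportional to `μ_Pass(z)`,
so the values of `z` with `μ_Pass(z) < μ(z) ε_m/κ` are also sacrificed, at cost at most `ε_m/κ`. -/

theorem neg_mul_log_le_exp_neg_one {x : ℝ} (hx : 0 ≤ x) : -(x * Real.log x) ≤ Real.exp (-1) := by
  rcases hx.eq_or_lt with rfl | hx
  · simpa using (Real.exp_pos (-1)).le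
  have h := Real.add_one_le_exp (-1 - Real.log x)
  rw [Real.exp_sub, Real.exp_log hx, le_div_iff₀ hx] at h
  linarith

/-- Square the bound `-y log y ≤ 1/e` at `y = √x`. -/
theorem mul_log_sq_le {x : ℝ} (hx : 0 ≤ x) (hx1 : x ≤ 1) :
    x * Real.log x ^ 2 ≤ 4 * Real.exp (-1) ^ 2 := by
  have h := neg_mul_log_le_exp_neg_one (Real.sqrt_nonneg x)
  have hl : Real.log √x = Real.log x / 2 := Real.log_sqrt hx
  have hn : 0 ≤ -(√x * Real.log √x) := by
    have : Real.log √x ≤ 0 := Real.log_nonpos (Real.sqrt_nonneg x) (by simpa using hx1)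
    nlinarith [Real.sqrt_nonneg x]
  have h2 := pow_le_pow_left₀ hn h 2
  have hs : √x ^ 2 = x := Real.sq_sqrt hx
  have h3 : (-(√x * Real.log √x)) ^ 2 = √x ^ 2 * (Real.log x) ^ 2 / 4 := by rw [hl]; ring
  rw [h3, hs] at h2
  linarith

/-- For the larger probability `-log q ≤ log 2`, so one of the two logarithms can be traded for `log
2`. This beats applying `mul_log_sq_le` twice and leaves slack for `binary_logb_sq_le`. -/
theorem binary_log_sq_le_of_half_le {q : ℝ} (hq : 1 / 2 ≤ q) (hq1 : q ≤ 1) :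
    q * Real.log q ^ 2 + (1 - q) * Real.log (1 - q) ^ 2
      ≤ 4 * Real.exp (-1) ^ 2 + Real.log 2 * Real.exp (-1) := by
  have h1 := mul_log_sq_le (x := 1 - q) (by linarith) (by linarith)
  have h2 := neg_mul_log_le_exp_neg_one (x := q) (by linarith)
  have hl0 : Real.log q ≤ 0 := Real.log_nonpos (by linarith) hq1
  have hl1 : -Real.log 2 ≤ Real.log q := by
    rw [← Real.log_inv]
    exact Real.log_le_log (by norm_num) (by linarith)
  have h3 : q * Real.log q ^ 2 ≤ Real.log 2 * -(q * Real.log q) := by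
    have : 0 ≤ q * (-Real.log q) * (Real.log 2 + Real.log q) :=
      mul_nonneg (mul_nonneg (by linarith) (by linarith)) (by linarith)
    linarith
  have h4 := mul_le_mul_of_nonneg_left h2 (Real.log_nonneg (x := 2) (by norm_num))
  linarith

theorem binary_log_sq_le {q : ℝ} (hq : 0 ≤ q) (hq1 : q ≤ 1) :
    q * Real.log q ^ 2 + (1 - q) * Real.log (1 - q) ^ 2
      ≤ 4 * Real.exp (-1) ^ 2 + Real.log 2 * Real.exp (-1) := by
  rcases le_total (1 / 2) q with h | h
  · exact binary_log_sq_le_of_half_le h hq1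
  · have := binary_log_sq_le_of_half_le (q := 1 - q) (by linarith) (by linarith)
    rw [sub_sub_cancel] at this
    linarith

/-- The right side is the last term of `V`. The spare `1/4` is spent in the last two cases of
`sum_mul_sq_le`. -/
theorem binary_logb_sq_le {q : ℝ} (hq : 0 ≤ q) (hq1 : q ≤ 1) :
    q * Real.logb 2 q ^ 2 + (1 - q) * Real.logb 2 (1 - q) ^ 2 + 1 / 4
      ≤ 4 * 2 / Real.exp 1 ^ 2 * Real.logb 2 (Real.exp 1) ^ 2 := by
  have h := binary_log_sq_le hq hq1
  have hl : 0 < Real.log 2 := Real.log_pos (by norm_num)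
  have hy : Real.exp 1 * Real.log 2 ≤ 2 := by
    have h1 := Real.exp_one_lt_d9
    have h2 := Real.log_two_lt_d9
    have h3 := Real.exp_pos 1
    nlinarith
  have hy0 : 0 < Real.exp 1 * Real.log 2 := mul_pos (Real.exp_pos 1) hl
  simp only [Real.logb, Real.log_exp]
  rw [Real.exp_neg] at h
  set e := Real.exp 1
  have he : 0 < e := Real.exp_pos 1
  set c := Real.log 2
  -- Multiplied by `e²`, with `y = e log 2 ≤ 2`, this reads `y + y²/4 ≤ 4`.
  have key : c * e⁻¹ + c ^ 2 / 4 ≤ 4 * e⁻¹ ^ 2 := by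
    have : e ^ 2 * (c * e⁻¹ + c ^ 2 / 4) ≤ e ^ 2 * (4 * e⁻¹ ^ 2) := by
      have e1 : e ^ 2 * (c * e⁻¹ + c ^ 2 / 4) = e * c + (e * c) ^ 2 / 4 := by
        field_simp
      have e2 : e ^ 2 * (4 * e⁻¹ ^ 2) = 4 := by field_simp
      rw [e1, e2]
      nlinarith
    exact le_of_mul_le_mul_left this (by positivity)
  have e3 : q * (Real.log q / c) ^ 2 + (1 - q) * (Real.log (1 - q) / c) ^ 2 + 1 / 4
      = (q * Real.log q ^ 2 + (1 - q) * Real.log (1 - q) ^ 2 + c ^ 2 / 4) / c ^ 2 := by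
    field_simp
  have e4 : 4 * 2 / e ^ 2 * (1 / c) ^ 2 = (8 * e⁻¹ ^ 2) / c ^ 2 := by
    field_simp; ring
  rw [e3, e4]
  gcongr
  linarith

/-- Invert the quadratic lower bound for `exp (-y)`: `(1 - y + y²/2)(1 + y + y²/2) = 1 + y⁴/4 ≥ 1`.
-/
theorem exp_le_quadratic_of_nonpos {y : ℝ} (hy : y ≤ 0) : Real.exp y ≤ 1 + y + y ^ 2 / 2 := by
  have h := Real.quadratic_le_exp_of_nonneg (x := -y) (by linarith)
  have hp : 0 < Real.exp y := Real.exp_pos y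
  rw [Real.exp_neg] at h
  have h1 : (1 + -y + (-y) ^ 2 / 2) * Real.exp y ≤ 1 := by
    have := mul_le_mul_of_nonneg_right h hp.le
    rwa [inv_mul_cancel₀ hp.ne'] at this
  have hq : 0 < 1 + -y + (-y) ^ 2 / 2 := by nlinarith [sq_nonneg y]
  have h2 : 1 ≤ (1 + -y + (-y) ^ 2 / 2) * (1 + y + y ^ 2 / 2) := by
    nlinarith [sq_nonneg (y ^ 2)]
  exact le_of_mul_le_mul_left (h1.trans h2) hq

theorem two_mul_three_pow_le_factorial (k : ℕ) : 2 * 3 ^ k ≤ (k + 2).factorial := by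
  induction k with
  | zero => simp
  | succ k ih =>
    rw [show k + 1 + 2 = (k + 2) + 1 from rfl, Nat.factorial_succ, pow_succ]
    nlinarith

/-- From the quadratic term on, the exponential series is dominated by a geometric series of ratio
`y/3`, because `(k+2)! ≥ 2·3^k`. -/
theorem exp_le_of_nonneg_of_lt_three {y : ℝ} (hy : 0 ≤ y) (hy3 : y < 3) :
    Real.exp y ≤ 1 + y + y ^ 2 / (2 * (1 - y / 3)) := by
  have hs : HasSum (fun k : ℕ => y ^ k / (k.factorial : ℝ)) (Real.exp y) := by
    rw [Real.exp_eq_exp_ℝ]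
    exact NormedSpace.expSeries_div_hasSum_exp y
  have hs2 := (hasSum_nat_add_iff' 2).2 hs
  have hg : HasSum (fun k : ℕ => y ^ 2 / 2 * (y / 3) ^ k) (y ^ 2 / 2 * (1 - y / 3)⁻¹) :=
    (hasSum_geometric_of_lt_one (by positivity) (by linarith)).mul_left _
  have hle := hasSum_le (fun k : ℕ => ?_) hs2 hg
  · simp only [Finset.sum_range_succ, Finset.sum_range_zero, Nat.factorial] at hle
    norm_num at hle
    have e : y ^ 2 / (2 * (1 - y / 3)) = y ^ 2 / 2 * (1 - y / 3)⁻¹ := by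
      rw [← div_div, div_eq_mul_inv]
    rw [e]
    linarith
  · have hf : (2 * 3 ^ k : ℝ) ≤ ((k + 2).factorial : ℝ) := by
      exact_mod_cast two_mul_three_pow_le_factorial k
    have e : y ^ 2 / 2 * (y / 3) ^ k = y ^ (k + 2) / (2 * 3 ^ k) := by
      rw [div_pow, pow_add]; field_simp
    rw [e]
    gcongr

/-- The exponential bound behind Bernstein's inequality. -/
theorem exp_le_bernstein {y B : ℝ} (hB : 0 ≤ B) (hB3 : B < 3) (hy : y ≤ B) :
    Real.exp y ≤ 1 + y + y ^ 2 / (2 * (1 - B / 3)) := by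
  rcases le_total y 0 with h | h
  · refine (exp_le_quadratic_of_nonpos h).trans ?_
    gcongr
    · linarith
    · linarith
  · refine (exp_le_of_nonneg_of_lt_three h (hy.trans_lt hB3)).trans ?_
    gcongr
    linarith

/-! ### Moments of a single round -/

theorem sum_mul_exp_le_bernstein {ι : Type*} [Fintype ι] {π Z : ι → ℝ} {b V lam : ℝ}
    (hπ : ∀ i, 0 ≤ π i) (hπ1 : ∑ i, π i = 1) (hZ : ∀ i, Z i ≤ b) (hb : 0 ≤ b)
    (hmean : ∑ i, π i * Z i ≤ 0) (hV : ∑ i, π i * Z i ^ 2 ≤ V)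
    (hlam : 0 ≤ lam) (hlamb : lam * b < 3) :
    ∑ i, π i * Real.exp (lam * Z i) ≤ Real.exp (lam ^ 2 * V / (2 * (1 - lam * b / 3))) := by
  have hd : 0 < 2 * (1 - lam * b / 3) := by linarith
  calc ∑ i, π i * Real.exp (lam * Z i)
      ≤ ∑ i, π i * (1 + lam * Z i + (lam * Z i) ^ 2 / (2 * (1 - lam * b / 3))) := by
        gcongr with i _
        · exact hπ i
        · exact exp_le_bernstein (by positivity) hlamb (mul_le_mul_of_nonneg_left (hZ i) hlam)
    _ = ∑ i, π i + lam * ∑ i, π i * Z i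
          + lam ^ 2 * (∑ i, π i * Z i ^ 2) / (2 * (1 - lam * b / 3)) := by
        rw [Finset.mul_sum, Finset.mul_sum, Finset.sum_div, ← Finset.sum_add_distrib,
          ← Finset.sum_add_distrib]
        exact Finset.sum_congr rfl fun i _ => by ring
    _ ≤ 1 + 0 + lam ^ 2 * V / (2 * (1 - lam * b / 3)) := by
        gcongr
        · exact hπ1.le
        · exact mul_nonpos_of_nonneg_of_nonpos hlam hmean
    _ ≤ _ := by
        rw [add_zero, add_comm]
        exact Real.add_one_le_exp _

/-- The second moment of `ξ - s - u`, where `m ≤ ξ ≤ M`, the mean of `ξ - s` is at most that of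
the non-negative `u`, and the second moment of `u` is controlled. -/
theorem sum_mul_sq_le {ι : Type*} [Fintype ι] {π ξ u : ι → ℝ} {m M s g K : ℝ}
    (hπ : ∀ i, 0 ≤ π i) (hπ1 : ∑ i, π i = 1) (hm : ∀ i, m ≤ ξ i) (hM : ∀ i, ξ i ≤ M)
    (hmM : m ≤ M) (hu : ∀ i, 0 ≤ u i) (hsg : s ≤ g)
    (hH : ∑ i, π i * u i ≤ 1) (hK : ∑ i, π i * u i ^ 2 + 1 / 4 ≤ K)
    (hmean : ∑ i, π i * (ξ i - s) ≤ ∑ i, π i * u i) :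
    ∑ i, π i * (ξ i - s - u i) ^ 2
      ≤ max ((M - g) ^ 2) ((m - g) ^ 2) + 2 * max (-(m - g)) 0 + K := by
  have hX := le_max_left ((M - g) ^ 2) ((m - g) ^ 2)
  have hY := le_max_right ((M - g) ^ 2) ((m - g) ^ 2)
  have hR := le_max_left (-(m - g)) 0
  have hR0 := le_max_right (-(m - g)) 0
  set D := max ((M - g) ^ 2) ((m - g) ^ 2)
  set R := max (-(m - g)) 0
  set H := ∑ i, π i * u i
  have hH0 : 0 ≤ H := Finset.sum_nonneg fun i _ => mul_nonneg (hπ i) (hu i)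
  -- The sign of the midpoint of `[m - s, M - s]` decides. If negative, `m - s` has the largest
  -- square in the interval. Otherwise the square is bounded by its chord, whose slope is
  -- nonnegative, so that `hmean` applies. In both cases `ξ ≥ m` bounds the cross term.
  rcases lt_or_ge (M - s + (m - s)) 0 with hneg | hnn
  · have hpt : ∀ i, π i * (ξ i - s - u i) ^ 2
        ≤ π i * (m - s) ^ 2 + (-2 * (m - s)) * (π i * u i) + π i * u i ^ 2 := by
      intro i
      have h1 : (ξ i - s - u i) ^ 2 ≤ (m - s) ^ 2 + (-2 * (m - s)) * u i + u i ^ 2 := by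
        have := hm i; have := hM i
        have a1 : 0 ≤ (ξ i - m) * (-(ξ i - s) - (m - s)) := mul_nonneg (by linarith) (by linarith)
        have a2 : 0 ≤ (ξ i - m) * u i := mul_nonneg (by linarith) (hu i)
        nlinarith
      have := mul_le_mul_of_nonneg_left h1 (hπ i)
      linarith
    have hsum := Finset.sum_le_sum fun i (_ : i ∈ Finset.univ) => hpt i
    rw [Finset.sum_add_distrib, Finset.sum_add_distrib, ← Finset.sum_mul, ← Finset.mul_sum, hπ1]
      at hsum
    change _ ≤ 1 * (m - s) ^ 2 + -2 * (m - s) * H + _ at hsum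
    have a1 : (m - s) ^ 2 ≤ (m - g) ^ 2 := by nlinarith
    have a2 : -2 * (m - s) * H ≤ -2 * (m - s) := by nlinarith
    linarith
  · have hpt : ∀ i, π i * (ξ i - s - u i) ^ 2
        ≤ (M - s + (m - s)) * (π i * (ξ i - s)) - π i * ((M - s) * (m - s))
          + (-2 * (m - s)) * (π i * u i) + π i * u i ^ 2 := by
      intro i
      have h1 : (ξ i - s - u i) ^ 2 ≤ (M - s + (m - s)) * (ξ i - s) - (M - s) * (m - s)
          + (-2 * (m - s)) * u i + u i ^ 2 := by
        have := hm i; have := hM i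
        have a1 : 0 ≤ (ξ i - m) * (M - ξ i) := mul_nonneg (by linarith) (by linarith)
        have a2 : 0 ≤ (ξ i - m) * u i := mul_nonneg (by linarith) (hu i)
        nlinarith
      have := mul_le_mul_of_nonneg_left h1 (hπ i)
      linarith
    have hsum := Finset.sum_le_sum fun i (_ : i ∈ Finset.univ) => hpt i
    rw [Finset.sum_add_distrib, Finset.sum_add_distrib, Finset.sum_sub_distrib, ← Finset.sum_mul,
      ← Finset.mul_sum, ← Finset.mul_sum, hπ1] at hsum
    change _ ≤ _ - _ + -2 * (m - s) * H + _ at hsum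
    have b1 := mul_le_mul_of_nonneg_left hmean hnn
    have b2 : (M - m) * H ≤ M - m := by nlinarith
    have b3 : ∑ i, π i * (ξ i - s - u i) ^ 2
        ≤ (M - m) * H - (M - s) * (m - s) + ∑ i, π i * u i ^ 2 := by linarith
    -- As a function of `s`, `-(M - s)(m - s)` is a concave parabola with peak at `(M + m)/2`. If
    -- `g` lies beyond the peak the peak value is used; otherwise the parabola increases up to `g`.
    rcases le_total (M - g) (-(m - g)) with hc | hc
    · have a1 : -((M - s) * (m - s)) ≤ ((M - m) / 2) ^ 2 := by
        nlinarith [sq_nonneg (M - s + (m - s))]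
      have a2 : ((M - m) / 2) ^ 2 ≤ (m - g) ^ 2 := by nlinarith
      linarith
    · have a1 : -((M - s) * (m - s)) ≤ -((M - g) * (m - g)) := by nlinarith
      -- With `X = M - g` and `Y = g - m`, what remains is `X + Y + XY ≤ X² + 2 max(Y,0) + 1/4`,
      -- which reduces to `X(1 - X) ≤ 1/4`.
      rcases le_total 0 (-(m - g)) with hY0 | hY0
      · nlinarith [sq_nonneg (M - g - 1 / 2)]
      · nlinarith [sq_nonneg (M - g - 1 / 2)]

/-! ### Energies of quantum behaviours -/

theorem EnergyObservable.eigenvalue_nonneg {H : Type} [NormedAddCommGroup H]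
    [InnerProductSpace ℂ H] (O : EnergyObservable H) (i : O.ι) : 0 ≤ O.eigenvalue i := by
  by_cases h : i = O.vacuum
  · rw [h, O.eigenvalue_vacuum]
  · exact zero_le_one.trans (O.one_le_eigenvalue i h)

/-- Needed for `γ·ω ≤ 0` in `increment_le_xiMax`. -/
theorem energy_nonneg_of_isRealisable {q : Behaviour} (hq : IsRealisable q) (x : Input) :
    0 ≤ q.2 x := by
  obtain ⟨H, _, _, _, O, ρ, M, hρ, -, -, -, hω⟩ := hq
  obtain ⟨e, he, hle⟩ := hω x
  refine le_trans (he.nonneg fun i => mul_nonneg (O.eigenvalue_nonneg i) ?_) hle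
  have := (hρ x).1.re_inner_nonneg_right (O.basis i)
  simpa using this

theorem energy_nonneg_of_mem_quantumSet {E ω : Input → ℝ} (h : (E, ω) ∈ quantumSet)
    (x : Input) : 0 ≤ ω x := by
  have hsub : quantumSet ⊆ {q : Behaviour | ∀ x, 0 ≤ q.2 x} := by
    refine convexHull_min (fun q hq x => energy_nonneg_of_isRealisable hq x) ?_
    intro q hq q' hq' a b ha hb _ x
    exact add_nonneg (mul_nonneg ha (hq x)) (mul_nonneg hb (hq' x))
  exact hsub h x

/-! ### A single round of the device -/

theorem sum_output (f : Output → ℝ) : ∑ a, f a = f 1 + f (-1) := by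
  rw [show (Finset.univ : Finset Output) = {1, -1} from by decide,
    Finset.sum_pair (by decide)]

@[simp] theorem outVal_one : outVal 1 = 1 := by simp [outVal]

@[simp] theorem outVal_neg_one : outVal (-1) = -1 := by simp [outVal]

/-- The probability `(1 + a E_x) / 2` of output `a` on input `x`. -/
def outProb (E : Input → ℝ) (a : Output) (x : Input) : ℝ := (1 + outVal a * E x) / 2

theorem sum_outProb (E : Input → ℝ) (x : Input) : ∑ a, outProb E a x = 1 := by
  rw [sum_output]; simp [outProb]; ring

theorem outProb_neg_one (E : Input → ℝ) (x : Input) : outProb E (-1) x = 1 - outProb E 1 x := by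
  simp [outProb]; ring

theorem outProb_le_one {E : Input → ℝ} {x : Input} (h : ∀ a, 0 ≤ outProb E a x) (a : Output) :
    outProb E a x ≤ 1 := by
  rw [← sum_outProb E x]
  exact Finset.single_le_sum (fun b _ => h b) (Finset.mem_univ a)

theorem sum_neg_outProb_mul_logb_le_one {E : Input → ℝ} {x : Input} :
    ∑ a, outProb E a x * -Real.logb 2 (outProb E a x) ≤ 1 := by
  rw [sum_output, outProb_neg_one]
  have h := Real.binEntropy_le_log_two (p := outProb E 1 x)
  rw [Real.binEntropy, Real.log_inv, Real.log_inv] at h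
  have hl : 0 < Real.log 2 := Real.log_pos (by norm_num)
  have : outProb E 1 x * -Real.logb 2 (outProb E 1 x)
      + (1 - outProb E 1 x) * -Real.logb 2 (1 - outProb E 1 x)
      = (outProb E 1 x * -Real.log (outProb E 1 x)
        + (1 - outProb E 1 x) * -Real.log (1 - outProb E 1 x)) / Real.log 2 := by
    simp only [Real.logb]; ring
  rw [this, div_le_one hl]
  exact h

theorem sum_outProb_mul_logb_sq_le {E : Input → ℝ} {x : Input} (h : ∀ a, 0 ≤ outProb E a x) :
    ∑ a, outProb E a x * Real.logb 2 (outProb E a x) ^ 2 + 1 / 4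
      ≤ 4 * 2 / Real.exp 1 ^ 2 * Real.logb 2 (Real.exp 1) ^ 2 := by
  rw [sum_output, outProb_neg_one]
  exact binary_logb_sq_le (h 1) (outProb_le_one h 1)

namespace ProtocolArgs

variable (P : ProtocolArgs)

theorem xi_le_xiMax (a : Output) (x : Input) : P.xi a x ≤ P.xiMax :=
  Finset.le_sup' (fun q : Output × Input => P.xi q.1 q.2) (Finset.mem_univ (a, x))

theorem xiMin_le_xi (a : Output) (x : Input) : P.xiMin ≤ P.xi a x :=
  Finset.inf'_le (fun q : Output × Input => P.xi q.1 q.2) (Finset.mem_univ (a, x))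

theorem V_eq : P.V = max ((P.xiMax - -P.gammaBar) ^ 2) ((P.xiMin - -P.gammaBar) ^ 2)
    + 2 * max (-(P.xiMin - -P.gammaBar)) 0
    + 4 * 2 / Real.exp 1 ^ 2 * Real.logb 2 (Real.exp 1) ^ 2 := by
  have h2 : Real.logb 2 2 = 1 := Real.logb_self_eq_one (by norm_num)
  simp only [V, Fintype.card_units_int, Nat.cast_ofNat, h2, one_mul, sub_neg_eq_add]
  rw [add_comm P.gammaBar]

theorem V_pos : 0 < P.V := by
  rw [V_eq]
  have hl : 0 < Real.logb 2 (Real.exp 1) :=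
    Real.logb_pos (by norm_num) (Real.one_lt_exp_iff.2 one_pos)
  have h1 : 0 ≤ max ((P.xiMax - -P.gammaBar) ^ 2) ((P.xiMin - -P.gammaBar) ^ 2) :=
    (sq_nonneg _).trans (le_max_left _ _)
  have h2 := le_max_right (-(P.xiMin - -P.gammaBar)) 0
  have h3 : 0 < 4 * 2 / Real.exp 1 ^ 2 * Real.logb 2 (Real.exp 1) ^ 2 := by positivity
  linarith

/-- The increment `ξ(a,x) + γ · ω + log₂ P(a|x)` of a round with behaviour `(E, ω)`. -/
def increment (E ω : Input → ℝ) (a : Output) (x : Input) : ℝ :=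
  P.xi a x + ∑ y, P.γ y * ω y + Real.logb 2 (outProb E a x)

variable {P}

/-- Since `p(x) ξ(a,x) = α_x + a β_x`, the mean is exactly `α₁ + α₂ + β·E + γ·ω - H(E)`. -/
theorem sum_increment_nonpos (hp : ∀ x, 0 < P.p x) (hp1 : ∑ x, P.p x = 1)
    (hT : IsTradeOff P.p P.ωpk P.α P.β P.γ)
    {E ω : Input → ℝ} (hQ : (E, ω) ∈ quantumSet) (hω : ∀ x, ω x ≤ P.ωpk x) :
    ∑ q : Output × Input, P.p q.2 * outProb E q.1 q.2 * P.increment E ω q.1 q.2 ≤ 0 := by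
  have h := hT.2 E ω hQ hω
  have hxi : ∀ x a, P.p x * P.xi a x = P.α x + outVal a * P.β x := by
    intro x a
    have := (hp x).ne'
    rw [xi]; field_simp
  have hsum : ∀ x, ∑ a, P.p x * outProb E a x * P.increment E ω a x
      = P.α x + P.β x * E x + P.p x * ∑ y, P.γ y * ω y
        + ∑ a, P.p x * outProb E a x * Real.logb 2 (outProb E a x) := by
    intro x
    have e : ∀ a, P.p x * outProb E a x * P.increment E ω a x
        = outProb E a x * (P.α x + outVal a * P.β x)
          + outProb E a x * (P.p x * ∑ y, P.γ y * ω y)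
          + P.p x * outProb E a x * Real.logb 2 (outProb E a x) := by
      intro a
      rw [← hxi, increment]; ring
    rw [Finset.sum_congr rfl fun a _ => e a, Finset.sum_add_distrib, Finset.sum_add_distrib,
      ← Finset.sum_mul, sum_outProb, one_mul, sum_output (fun a => outProb E a x * (_ + _))]
    simp only [outProb, outVal_one, outVal_neg_one]
    ring
  rw [Fintype.sum_prod_type, Finset.sum_comm, Finset.sum_congr rfl fun x _ => hsum x]
  rw [condEntropy, Finset.sum_comm] at h
  change _ ≤ -∑ x, ∑ a, P.p x * outProb E a x * Real.logb 2 (outProb E a x) at h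
  rw [Finset.sum_add_distrib, Finset.sum_add_distrib, Finset.sum_add_distrib, ← Finset.sum_mul,
    hp1, one_mul]
  linarith

theorem gammaBar_le_sum_mul (hγ : ∀ x, P.γ x ≤ 0) {ω : Input → ℝ} (hω1 : ∀ x, ω x ≤ 1) :
    P.gammaBar ≤ ∑ y, P.γ y * ω y :=
  Finset.sum_le_sum fun x _ => by nlinarith [hγ x, hω1 x]

theorem increment_le_xiMax (hγ : ∀ x, P.γ x ≤ 0) {E ω : Input → ℝ} (hω0 : ∀ x, 0 ≤ ω x)
    (hE : ∀ a x, 0 ≤ outProb E a x) (a : Output) (x : Input) :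
    P.increment E ω a x ≤ P.xiMax := by
  have h1 := P.xi_le_xiMax a x
  have h2 : ∑ y, P.γ y * ω y ≤ 0 :=
    Finset.sum_nonpos fun y _ => mul_nonpos_of_nonpos_of_nonneg (hγ y) (hω0 y)
  have h3 : Real.logb 2 (outProb E a x) ≤ 0 :=
    Real.logb_nonpos (by norm_num) (hE a x) (outProb_le_one (fun b => hE b x) a)
  rw [increment]; linarith

theorem sum_roundProb (hp1 : ∑ x, P.p x = 1) (E : Input → ℝ) :
    ∑ q : Output × Input, P.p q.2 * outProb E q.1 q.2 = 1 := by
  rw [Fintype.sum_prod_type, Finset.sum_comm]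
  simp only [← Finset.mul_sum, sum_outProb, mul_one, hp1]

theorem sum_increment_sq_le (hp : ∀ x, 0 < P.p x) (hp1 : ∑ x, P.p x = 1)
    (hT : IsTradeOff P.p P.ωpk P.α P.β P.γ) (hpk : ∀ x, P.ωpk x ≤ 1)
    {E ω : Input → ℝ} (hQ : (E, ω) ∈ quantumSet) (hω : ∀ x, ω x ≤ P.ωpk x)
    (hE : ∀ a x, 0 ≤ outProb E a x) :
    ∑ q : Output × Input, P.p q.2 * outProb E q.1 q.2 * P.increment E ω q.1 q.2 ^ 2 ≤ P.V := by
  have hmean := sum_increment_nonpos hp hp1 hT hQ hω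
  have avg : ∀ (f : Output → Input → ℝ) (C : ℝ), (∀ x, ∑ a, outProb E a x * f a x ≤ C) →
      ∑ q : Output × Input, P.p q.2 * outProb E q.1 q.2 * f q.1 q.2 ≤ C := by
    intro f C hf
    rw [Fintype.sum_prod_type, Finset.sum_comm]
    calc ∑ x, ∑ a, P.p x * outProb E a x * f a x = ∑ x, P.p x * ∑ a, outProb E a x * f a x := by
          simp only [Finset.mul_sum, mul_assoc]
      _ ≤ ∑ x, P.p x * C :=
          Finset.sum_le_sum fun x _ => mul_le_mul_of_nonneg_left (hf x) (hp x).le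
      _ = C := by rw [← Finset.sum_mul, hp1, one_mul]
  have key := sum_mul_sq_le (ι := Output × Input)
    (π := fun q => P.p q.2 * outProb E q.1 q.2) (ξ := fun q => P.xi q.1 q.2)
    (u := fun q => -Real.logb 2 (outProb E q.1 q.2)) (m := P.xiMin) (M := P.xiMax)
    (s := -∑ y, P.γ y * ω y) (g := -P.gammaBar)
    (K := 4 * 2 / Real.exp 1 ^ 2 * Real.logb 2 (Real.exp 1) ^ 2)
    (fun q => mul_nonneg (hp q.2).le (hE q.1 q.2)) (sum_roundProb hp1 E)
    (fun q => P.xiMin_le_xi q.1 q.2) (fun q => P.xi_le_xiMax q.1 q.2)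
    ((P.xiMin_le_xi 1 0).trans (P.xi_le_xiMax 1 0))
    (fun q => neg_nonneg.2 <| Real.logb_nonpos (by norm_num) (hE q.1 q.2)
      (outProb_le_one (fun b => hE b q.2) q.1))
    (neg_le_neg (gammaBar_le_sum_mul hT.1 fun x => (hω x).trans (hpk x)))
    (avg (fun a x => -Real.logb 2 (outProb E a x)) 1 fun x => sum_neg_outProb_mul_logb_le_one)
    ?_ ?_
  · rw [V_eq]
    refine le_trans (le_of_eq (Finset.sum_congr rfl fun q _ => ?_)) key
    rw [increment]; ring
  · have := avg (fun a x => (-Real.logb 2 (outProb E a x)) ^ 2)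
      (4 * 2 / Real.exp 1 ^ 2 * Real.logb 2 (Real.exp 1) ^ 2 - 1 / 4) fun x => by
        have := sum_outProb_mul_logb_sq_le fun a => hE a x
        simp only [neg_sq]
        linarith
    linarith
  · rw [← sub_nonpos, ← Finset.sum_sub_distrib]
    refine le_trans (le_of_eq (Finset.sum_congr rfl fun q _ => ?_)) hmean
    rw [increment]; ring

theorem sum_exp_increment_le (hp : ∀ x, 0 < P.p x) (hp1 : ∑ x, P.p x = 1)
    (hT : IsTradeOff P.p P.ωpk P.α P.β P.γ) (hpk : ∀ x, P.ωpk x ≤ 1) (hxi : 0 ≤ P.xiMax)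
    {E ω : Input → ℝ} (hQ : (E, ω) ∈ quantumSet) (hω : ∀ x, ω x ≤ P.ωpk x)
    (hE : ∀ a x, 0 ≤ outProb E a x) {lam : ℝ} (hlam : 0 ≤ lam) (hlamb : lam * P.xiMax < 3) :
    ∑ q : Output × Input,
        P.p q.2 * outProb E q.1 q.2 * Real.exp (lam * P.increment E ω q.1 q.2)
      ≤ Real.exp (lam ^ 2 * P.V / (2 * (1 - lam * P.xiMax / 3))) :=
  sum_mul_exp_le_bernstein (fun q => mul_nonneg (hp q.2).le (hE q.1 q.2)) (sum_roundProb hp1 E)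
    (fun q => increment_le_xiMax hT.1 (energy_nonneg_of_mem_quantumSet hQ) hE q.1 q.2) hxi
    (sum_increment_nonpos hp hp1 hT hQ hω)
    (sum_increment_sq_le hp hp1 hT hpk hQ hω hE) hlam hlamb

end ProtocolArgs

/-- Optimisation of the exponent in Bernstein's inequality. -/
theorem exists_bernstein_exponent {v c l : ℝ} (hv : 0 < v) (hc : 0 ≤ c) (hl : 0 ≤ l) :
    ∃ lam, 0 ≤ lam ∧ lam * c < 1 ∧
      lam ^ 2 * v / (2 * (1 - lam * c)) - lam * (√(2 * v * l) + c * l) = -l := by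
  -- `w` is the optimal exponent when `c = 0`. Damping it by `1 + c w` makes `1 - lam * c = 1/(1 + c
  -- w)`, and `w² v = 2l` then collapses the expression to `-l`.
  set w := √(2 * l / v) with hw
  have hw0 : 0 ≤ w := Real.sqrt_nonneg _
  have hw2 : w ^ 2 * v = 2 * l := by
    rw [hw, Real.sq_sqrt (by positivity)]; field_simp
  have hs : √(2 * v * l) = w * v := by
    rw [show 2 * v * l = (w * v) ^ 2 by rw [mul_pow, pow_two v, ← mul_assoc, hw2]; ring]
    exact Real.sqrt_sq (by positivity)
  have hd : 0 < 1 + c * w := by positivity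
  have h1 : 1 - w / (1 + c * w) * c = 1 / (1 + c * w) := by field_simp; ring
  refine ⟨w / (1 + c * w), by positivity, ?_, ?_⟩
  · have : 0 < 1 / (1 + c * w) := by positivity
    linarith
  · rw [h1, hs]
    have : (w / (1 + c * w)) ^ 2 * v / (2 * (1 / (1 + c * w)))
        - w / (1 + c * w) * (w * v + c * l)
        = (w ^ 2 * v / 2 - (w ^ 2 * v + c * w * l)) / (1 + c * w) := by
      field_simp
    rw [this, hw2, div_eq_iff hd.ne']
    ring

theorem ProtocolArgs.exists_tail_exponent (P : ProtocolArgs) {n : ℕ} (hn : 1 ≤ n)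
    (hxi : 0 ≤ P.xiMax) (h0 : 0 < P.εt) (h1 : P.εt ≤ 1) :
    ∃ lam, 0 ≤ lam ∧ lam * P.xiMax < 3 ∧
      Real.exp (lam ^ 2 * P.V / (2 * (1 - lam * P.xiMax / 3))) ^ n
        ≤ P.εt * Real.exp (lam * (n * P.t n)) := by
  have hn0 : (0 : ℝ) < n := by exact_mod_cast hn
  have hl : 0 ≤ Real.logb 2 (1 / P.εt) :=
    Real.logb_nonneg (by norm_num) (by rw [le_div_iff₀ h0]; linarith)
  -- Bernstein works with natural logarithms; the base 2 in `t` only makes `t` larger, as `log 2 ≤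
  -- 1`.
  have hlog : -Real.logb 2 (1 / P.εt) ≤ Real.log P.εt := by
    have h2 : 0 < Real.log 2 := Real.log_pos (by norm_num)
    have h2' : Real.log 2 ≤ 1 := by have := Real.log_two_lt_d9; linarith
    have h3 : Real.log P.εt ≤ 0 := Real.log_nonpos h0.le h1
    rw [Real.logb, one_div, Real.log_inv, neg_div, neg_neg, div_le_iff₀ h2]
    nlinarith
  set l := Real.logb 2 (1 / P.εt)
  obtain ⟨lam, hlam, hlc, h⟩ := exists_bernstein_exponent (v := n * P.V) (c := P.xiMax / 3)
    (l := l) (mul_pos hn0 P.V_pos) (by positivity) hl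
  have ht : n * P.t n = √(2 * (n * P.V) * l) + P.xiMax / 3 * l := by
    have hV := P.V_pos
    have : n * (√(2 * P.V) * √(l / n)) = √(2 * (n * P.V) * l) := by
      rw [← Real.sqrt_mul (by positivity)]
      nth_rewrite 1 [← Real.sqrt_sq hn0.le]
      rw [← Real.sqrt_mul (by positivity)]
      congr 1
      field_simp
    rw [ProtocolArgs.t, mul_add, this]
    change _ + n * (P.xiMax / 3 * (l / n)) = _
    field_simp
  refine ⟨lam, hlam, by linarith, ?_⟩
  rw [← Real.exp_nat_mul]
  nth_rewrite 1 [← Real.exp_log h0]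
  rw [← Real.exp_add, Real.exp_le_exp, ht]
  have e : (n : ℝ) * (lam ^ 2 * P.V / (2 * (1 - lam * P.xiMax / 3)))
      = lam ^ 2 * (n * P.V) / (2 * (1 - lam * (P.xiMax / 3))) := by
    rw [← mul_div_assoc lam]; ring
  rw [e]
  linarith

/-! ### Sums of products adapted to the past -/

theorem sum_prod_adapted_succ {S : Type*} [Fintype S] {n : ℕ}
    (g : (i : Fin (n + 1)) → (Fin i → S) → S → ℝ) :
    ∑ s : Fin (n + 1) → S, ∏ i, g i (fun j => s (Fin.castLE i.isLt.le j)) (s i) =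
      ∑ s : Fin n → S,
        (∏ i : Fin n, g i.castSucc (fun j => s (Fin.castLE i.isLt.le j)) (s i)) *
          ∑ t, g (Fin.last n) s t := by
  rw [← (Fin.snocEquiv fun _ : Fin (n + 1) => S).sum_comp, Fintype.sum_prod_type_right]
  refine Finset.sum_congr rfl fun s _ => ?_
  rw [Finset.mul_sum]
  refine Finset.sum_congr rfl fun t _ => ?_
  rw [Fin.prod_univ_castSucc]
  congr 1
  · refine Finset.prod_congr rfl fun i _ => ?_
    congr 1
    · funext j
      exact Fin.snoc_castSucc (α := fun _ => S) t s (Fin.castLE i.isLt.le j)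
    · exact Fin.snoc_castSucc (α := fun _ => S) t s i
  · congr 1
    · funext j
      exact Fin.snoc_castSucc (α := fun _ => S) t s j
    · exact Fin.snoc_last (α := fun _ => S) t s

/-- The tower property in finite form: the factor of the last round is summed first, with its past
fixed. This replaces a supermartingale argument. -/
theorem sum_prod_adapted_le {S : Type*} [Fintype S] {C : ℝ} (hC : 0 ≤ C) :
    ∀ {n : ℕ} (g : (i : Fin n) → (Fin i → S) → S → ℝ), (∀ i h s, 0 ≤ g i h s) →
      (∀ i h, ∑ s, g i h s ≤ C) →
      ∑ s : Fin n → S, ∏ i, g i (fun j => s (Fin.castLE i.isLt.le j)) (s i) ≤ C ^ n := by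
  intro n
  induction n with
  | zero => intro g _ _; simp
  | succ n ih =>
    intro g hg hsum
    rw [sum_prod_adapted_succ, pow_succ]
    calc _ ≤ ∑ s : Fin n → S,
          (∏ i : Fin n, g i.castSucc (fun j => s (Fin.castLE i.isLt.le j)) (s i)) * C :=
        Finset.sum_le_sum fun s _ => mul_le_mul_of_nonneg_left (hsum _ _)
          (Finset.prod_nonneg fun i _ => hg _ _ _)
      _ ≤ C ^ n * C := by
        rw [← Finset.sum_mul]
        exact mul_le_mul_of_nonneg_right
          (ih (fun i => g i.castSucc) (fun i => hg i.castSucc) (fun i => hsum i.castSucc)) hC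

theorem sum_prod_adapted_eq_one {S : Type*} [Fintype S] :
    ∀ {n : ℕ} (g : (i : Fin n) → (Fin i → S) → S → ℝ), (∀ i h, ∑ s, g i h s = 1) →
      ∑ s : Fin n → S, ∏ i, g i (fun j => s (Fin.castLE i.isLt.le j)) (s i) = 1 := by
  intro n
  induction n with
  | zero => intro g _; simp
  | succ n ih =>
    intro g hsum
    rw [sum_prod_adapted_succ]
    simp only [hsum, mul_one]
    exact ih (fun i => g i.castSucc) (fun i => hsum i.castSucc)

/-! ### The distribution of the outcomes -/

theorem prob_nonneg {Ω : Type*} (μ : PMF Ω) (S : Set Ω) : 0 ≤ prob μ S := ENNReal.toReal_nonneg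

theorem toOuterMeasure_le_one {Ω : Type*} (μ : PMF Ω) (S : Set Ω) : μ.toOuterMeasure S ≤ 1 := by
  rw [PMF.toOuterMeasure_apply, ← μ.tsum_coe]
  exact ENNReal.tsum_le_tsum fun w => Set.indicator_le_self _ _ _

theorem toOuterMeasure_ne_top {Ω : Type*} (μ : PMF Ω) (S : Set Ω) : μ.toOuterMeasure S ≠ ⊤ :=
  ne_top_of_le_ne_top ENNReal.one_ne_top (toOuterMeasure_le_one μ S)

theorem prob_mono {Ω : Type*} (μ : PMF Ω) {S T : Set Ω} (h : S ⊆ T) : prob μ S ≤ prob μ T :=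
  ENNReal.toReal_mono (toOuterMeasure_ne_top μ T) (μ.toOuterMeasure.mono h)

theorem prob_singleton {Ω : Type*} (μ : PMF Ω) (w : Ω) : prob μ {w} = (μ w).toReal := by
  rw [prob, PMF.toOuterMeasure_apply_singleton]

theorem prob_union_le {Ω : Type*} (μ : PMF Ω) (S T : Set Ω) :
    prob μ (S ∪ T) ≤ prob μ S + prob μ T := by
  rw [prob, prob, prob, ← ENNReal.toReal_add (toOuterMeasure_ne_top μ S)
    (toOuterMeasure_ne_top μ T)]
  exact ENNReal.toReal_mono
    (ENNReal.add_ne_top.2 ⟨toOuterMeasure_ne_top μ S, toOuterMeasure_ne_top μ T⟩)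
    (MeasureTheory.measure_union_le S T)

theorem prob_compl {Ω : Type*} (μ : PMF Ω) (S : Set Ω) : prob μ Sᶜ = 1 - prob μ S := by
  have h : μ.toOuterMeasure S + μ.toOuterMeasure Sᶜ = 1 := by
    rw [PMF.toOuterMeasure_apply, PMF.toOuterMeasure_apply, ← ENNReal.tsum_add, ← μ.tsum_coe]
    refine tsum_congr fun w => ?_
    exact congrFun (Set.indicator_self_add_compl S μ) w
  have h' := congrArg ENNReal.toReal h
  rw [ENNReal.toReal_add (toOuterMeasure_ne_top μ S) (toOuterMeasure_ne_top μ _)] at h'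
  simp only [ENNReal.toReal_one] at h'
  rw [prob, prob]; linarith

theorem marginalZ_apply {A Z : Type*} [Fintype A] (ν : PMF (A × Z)) (z : Z) :
    marginalZ ν z = ∑ a, ν (a, z) := by
  classical
  rw [marginalZ, PMF.map_apply, ENNReal.tsum_prod', tsum_fintype]
  refine Finset.sum_congr rfl fun a _ => ?_
  rw [tsum_eq_single z fun z' hz => if_neg fun h => hz h.symm, if_pos rfl]

theorem tsum_toOuterMeasure_fiber {Ω L : Type*} (μ : PMF Ω) (f : Ω → L) :
    ∑' l, μ.toOuterMeasure {w | f w = l} = 1 := by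
  rw [← (μ.map f).tsum_coe]
  refine tsum_congr fun l => ?_
  rw [← PMF.toOuterMeasure_apply_singleton, PMF.toOuterMeasure_map_apply]
  rfl

section Device

variable {n : ℕ} {L : Type*}

/-- The runs that agree with `w` in `Λ` and in the first `k` rounds. -/
def prefixEvent (k : ℕ) (w : Outcome n L) : Set (Outcome n L) :=
  {w' | w'.2.2 = w.2.2 ∧ ∀ j : Fin n, (j : ℕ) < k → w'.1 j = w.1 j ∧ w'.2.1 j = w.2.1 j}

theorem pastEvent_eq_prefixEvent (i : Fin n) (w : Outcome n L) :
    pastEvent i (past i w) w.2.2 = prefixEvent i w := by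
  ext w'
  simp only [pastEvent, prefixEvent, past, Set.mem_ofPred_eq, Prod.mk.injEq, funext_iff]
  constructor
  · rintro ⟨⟨h1, h2⟩, h3⟩
    exact ⟨h3, fun j hj => ⟨h1 ⟨j, hj⟩, h2 ⟨j, hj⟩⟩⟩
  · rintro ⟨h3, h⟩
    exact ⟨⟨fun j => (h (Fin.castLE i.isLt.le j) j.isLt).1,
      fun j => (h (Fin.castLE i.isLt.le j) j.isLt).2⟩, h3⟩

theorem prefixEvent_succ (i : Fin n) (w : Outcome n L) :
    prefixEvent (i + 1) w =
      pastEvent i (past i w) w.2.2 ∩ {w' | w'.2.1 i = w.2.1 i} ∩ {w' | w'.1 i = w.1 i} := by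
  rw [pastEvent_eq_prefixEvent]
  ext w'
  simp only [prefixEvent, Set.mem_ofPred_eq, Set.mem_inter_iff]
  constructor
  · rintro ⟨h, h'⟩
    exact ⟨⟨⟨h, fun j hj => h' j (by omega)⟩, (h' i (by omega)).2⟩, (h' i (by omega)).1⟩
  · rintro ⟨⟨⟨h, h'⟩, hx⟩, ha⟩
    refine ⟨h, fun j hj => ?_⟩
    rcases Nat.lt_succ_iff_lt_or_eq.1 hj with hj | hj
    · exact h' j hj
    · obtain rfl : j = i := Fin.ext hj
      exact ⟨ha, hx⟩

theorem prefixEvent_zero (w : Outcome n L) : prefixEvent 0 w = {w' | w'.2.2 = w.2.2} := by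
  simp [prefixEvent]

theorem prefixEvent_full (w : Outcome n L) : prefixEvent n w = {w} := by
  ext w'
  simp only [prefixEvent, Set.mem_ofPred_eq, Set.mem_singleton_iff]
  constructor
  · rintro ⟨h, h'⟩
    exact Prod.ext (funext fun j => (h' j j.isLt).1)
      (Prod.ext (funext fun j => (h' j j.isLt).2) h)
  · rintro rfl
    exact ⟨rfl, fun _ _ => ⟨rfl, rfl⟩⟩

variable {μ : PMF (Outcome n L)} {p ωpk ωavg : Input → ℝ} {εω : ℝ}
  {corr energy : (i : Fin n) → History i → L → Input → ℝ}

/-- The probability that the device outputs `Aᵢ` in round `i`, given the past, in the run `w`. -/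
def roundProb (corr : (i : Fin n) → History i → L → Input → ℝ) (w : Outcome n L) (i : Fin n) : ℝ :=
  outProb (corr i (past i w) w.2.2) (w.1 i) (w.2.1 i)

namespace DeviceAssumptions

/-- The chain rule; fixing one more round brings in one use each of `input` and `output`. -/
theorem prob_prefixEvent (hμ : DeviceAssumptions μ p ωpk ωavg εω corr energy) (w : Outcome n L)
    {k : ℕ} (hk : k ≤ n) :
    prob μ (prefixEvent k w) = prob μ {w' | w'.2.2 = w.2.2} *
      ∏ i : Fin k, p (w.2.1 (Fin.castLE hk i)) * roundProb corr w (Fin.castLE hk i) := by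
  induction k with
  | zero => simp [prefixEvent_zero]
  | succ k ih =>
    have hk' : k ≤ n := (Nat.le_succ k).trans hk
    have h1 := prefixEvent_succ ⟨k, hk⟩ w
    have h2 := pastEvent_eq_prefixEvent ⟨k, hk⟩ w
    rw [Fin.prod_univ_castSucc]
    change prob μ (prefixEvent ((⟨k, hk⟩ : Fin n) + 1) w) = _
    rw [h1, hμ.output, hμ.input, h2, ih hk']
    change (roundProb corr w ⟨k, hk⟩) * (p (w.2.1 ⟨k, hk⟩) * (_ * _)) =
      _ * ((∏ i : Fin k, p (w.2.1 (Fin.castLE hk' i)) * roundProb corr w (Fin.castLE hk' i))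
        * (p (w.2.1 ⟨k, hk⟩) * roundProb corr w ⟨k, hk⟩))
    ring

theorem toReal_apply (hμ : DeviceAssumptions μ p ωpk ωavg εω corr energy) (w : Outcome n L) :
    (μ w).toReal = prob μ {w' | w'.2.2 = w.2.2} *
      ∏ i, p (w.2.1 i) * roundProb corr w i := by
  have := hμ.prob_prefixEvent w le_rfl
  rw [prefixEvent_full, prob_singleton] at this
  simpa using this

/-- Read off from `output`, whose left side is a probability; this needs a past of positive
probability. -/
theorem outProb_nonneg (hμ : DeviceAssumptions μ p ωpk ωavg εω corr energy) (hp : ∀ x, 0 < p x)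
    (i : Fin n) (h : History i) (l : L) (hpos : 0 < prob μ (pastEvent i h l)) (a : Output)
    (x : Input) : 0 ≤ outProb (corr i h l) a x := by
  have h1 := hμ.output i h l x a
  rw [hμ.input] at h1
  have h2 := prob_nonneg μ (pastEvent i h l ∩ {w | w.2.1 i = x} ∩ {w | w.1 i = a})
  rw [h1] at h2
  exact nonneg_of_mul_nonneg_left h2 (mul_pos (hp x) hpos)

theorem pastEvent_prob_pos {w : Outcome n L} (hw : 0 < (μ w).toReal) (i : Fin n) :
    0 < prob μ (pastEvent i (past i w) w.2.2) := by
  rw [← prob_singleton] at hw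
  refine hw.trans_le (prob_mono μ ?_)
  rintro _ rfl
  exact ⟨rfl, rfl⟩

/-- With the inputs held fixed, the round probabilities sum to one over the outputs, last round
first. -/
theorem toReal_marginalZ (hμ : DeviceAssumptions μ p ωpk ωavg εω corr energy)
    (z : (Fin n → Input) × L) :
    (marginalZ μ z).toReal = prob μ {w' | w'.2.2 = z.2} * ∏ i, p (z.1 i) := by
  rw [marginalZ_apply, ENNReal.toReal_sum fun a _ => μ.apply_ne_top _]
  have h1 : ∑ a : Fin n → Output, ∏ i, roundProb corr (a, z) i = 1 :=
    sum_prod_adapted_eq_one (S := Output)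
      (fun i h a => outProb (corr i (h, fun j => z.1 (Fin.castLE i.isLt.le j)) z.2) a (z.1 i))
      fun i h => sum_outProb _ _
  simp only [hμ.toReal_apply, Finset.prod_mul_distrib]
  rw [← Finset.mul_sum, ← Finset.mul_sum, h1, mul_one]

/-- The conditional distribution of the outputs is the product of those of the rounds. -/
theorem toReal_apply_eq_marginalZ_mul (hμ : DeviceAssumptions μ p ωpk ωavg εω corr energy)
    (w : Outcome n L) :
    (μ w).toReal = (marginalZ μ w.2).toReal * ∏ i, roundProb corr w i := by
  rw [hμ.toReal_marginalZ, hμ.toReal_apply, Finset.prod_mul_distrib, mul_assoc]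

end DeviceAssumptions

/-- Outcomes, listed by the value of `Λ` and the sequence of pairs `(Aᵢ, Xᵢ)`. -/
def outcomeEquiv (n : ℕ) (L : Type*) : L × (Fin n → Output × Input) ≃ Outcome n L where
  toFun q := (fun i => (q.2 i).1, fun i => (q.2 i).2, q.1)
  invFun w := (w.2.2, fun i => (w.1 i, w.2.1 i))
  left_inv _ := rfl
  right_inv _ := rfl

theorem tsum_outcome (F : Outcome n L → ℝ≥0∞) :
    ∑' w, F w = ∑' l, ∑ s : Fin n → Output × Input, F (outcomeEquiv n L (l, s)) := by
  rw [← (outcomeEquiv n L).tsum_eq, ENNReal.tsum_prod']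
  simp only [tsum_fintype]

/-- The sum over all rounds of `ξ(Aᵢ,Xᵢ) + γ · ωᵢ + log₂ P(Aᵢ|Xᵢ,Wᵢ,Λ)`. -/
def totalIncrement (P : ProtocolArgs) (corr energy : (i : Fin n) → History i → L → Input → ℝ)
    (w : Outcome n L) : ℝ :=
  ∑ i, P.increment (corr i (past i w) w.2.2) (energy i (past i w) w.2.2) (w.1 i) (w.2.1 i)

variable {P : ProtocolArgs}

theorem sum_exp_totalIncrement_le (hP : P.Valid n)
    (hμ : DeviceAssumptions μ P.p P.ωpk P.ωavg P.εω corr energy)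
    {lam : ℝ} (hlam : 0 ≤ lam) (hlamb : lam * P.xiMax < 3) (l : L) :
    ∑ s : Fin n → Output × Input, (μ (outcomeEquiv n L (l, s))).toReal *
        Real.exp (lam * totalIncrement P corr energy (outcomeEquiv n L (l, s)))
      ≤ prob μ {w | w.2.2 = l} *
        Real.exp (lam ^ 2 * P.V / (2 * (1 - lam * P.xiMax / 3))) ^ n := by
  classical
  set hist : (i : Fin n) → (Fin i → Output × Input) → History i :=
    fun i h => (fun j => (h j).1, fun j => (h j).2) with hhist
  -- Pasts of probability zero get weight `0`, since nonnegativity of `outProb` is not available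
  -- there. Runs of positive probability never meet them.
  set g : (i : Fin n) → (Fin i → Output × Input) → Output × Input → ℝ := fun i h q =>
    if 0 < prob μ (pastEvent i (hist i h) l) then
      P.p q.2 * outProb (corr i (hist i h) l) q.1 q.2 *
        Real.exp (lam * P.increment (corr i (hist i h) l) (energy i (hist i h) l) q.1 q.2)
    else 0 with hg
  have hg0 : ∀ i h q, 0 ≤ g i h q := by
    intro i h q
    simp only [hg]
    split_ifs with hpos
    · exact mul_nonneg (mul_nonneg (hP.p_pos _).le
        (hμ.outProb_nonneg hP.p_pos i _ l hpos _ _)) (Real.exp_pos _).le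
    · exact le_rfl
  have hgC : ∀ i h, ∑ q, g i h q
      ≤ Real.exp (lam ^ 2 * P.V / (2 * (1 - lam * P.xiMax / 3))) := by
    intro i h
    by_cases hpos : 0 < prob μ (pastEvent i (hist i h) l)
    · simp only [hg, if_pos hpos]
      exact P.sum_exp_increment_le hP.p_pos hP.p_sum hP.tradeOff hP.ωpk_le_one hP.xiMax_nonneg
        (hμ.quantum i _ l) (hμ.maxPeak i _ l) (hμ.outProb_nonneg hP.p_pos i _ l hpos) hlam hlamb
    · simp only [hg, if_neg hpos, Finset.sum_const_zero]
      exact (Real.exp_pos _).le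
  refine le_trans ?_ (mul_le_mul_of_nonneg_left
    (sum_prod_adapted_le (Real.exp_pos _).le g hg0 hgC) (prob_nonneg μ _))
  rw [Finset.mul_sum]
  refine Finset.sum_le_sum fun s _ => ?_
  set w := outcomeEquiv n L (l, s) with hw
  rcases (ENNReal.toReal_nonneg (a := μ w)).eq_or_lt with h0 | h0
  · rw [← h0, zero_mul]
    exact mul_nonneg (prob_nonneg μ _) (Finset.prod_nonneg fun i _ => hg0 _ _ _)
  · have hgi : ∀ i : Fin n, g i (fun j => s (Fin.castLE i.isLt.le j)) (s i)
        = P.p (w.2.1 i) * roundProb corr w i * Real.exp (lam * P.increment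
          (corr i (past i w) w.2.2) (energy i (past i w) w.2.2) (w.1 i) (w.2.1 i)) := fun i =>
      if_pos (DeviceAssumptions.pastEvent_prob_pos h0 i)
    rw [Finset.prod_congr rfl fun i _ => hgi i, Finset.prod_mul_distrib, ← Real.exp_sum,
      ← Finset.mul_sum, ← mul_assoc, hμ.toReal_apply w]
    exact le_rfl

/-- Bernstein's inequality for the device. -/
theorem prob_lt_totalIncrement_le (hP : P.Valid n)
    (hμ : DeviceAssumptions μ P.p P.ωpk P.ωavg P.εω corr energy) :
    prob μ {w | n * P.t n < totalIncrement P corr energy w} ≤ P.εt := by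
  classical
  obtain ⟨lam, hlam, hlamb, hexp⟩ :=
    P.exists_tail_exponent hP.rounds_pos hP.xiMax_nonneg hP.εt_pos hP.εt_le_one
  refine ENNReal.toReal_le_of_le_ofReal hP.εt_pos.le ?_
  rw [PMF.toOuterMeasure_apply]
  set T := totalIncrement P corr energy
  -- Markov's inequality for `exp (lam * T)`, pointwise; it is then summed over each fibre of `Λ`.
  have markov : ∀ w, Set.indicator {w | n * P.t n < T w} μ w
      ≤ ENNReal.ofReal ((μ w).toReal * Real.exp (lam * T w) * Real.exp (-(lam * (n * P.t n)))) := by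
    intro w
    by_cases hw : n * P.t n < T w
    · rw [Set.indicator_of_mem (by exact hw)]
      nth_rewrite 1 [← ENNReal.ofReal_toReal (μ.apply_ne_top w)]
      refine ENNReal.ofReal_le_ofReal ?_
      rw [mul_assoc, ← Real.exp_add]
      refine le_mul_of_one_le_right ENNReal.toReal_nonneg (Real.one_le_exp ?_)
      nlinarith
    · rw [Set.indicator_of_notMem (by exact hw)]
      exact zero_le
  calc ∑' w, Set.indicator {w | n * P.t n < T w} μ w
      ≤ ∑' w, ENNReal.ofReal
          ((μ w).toReal * Real.exp (lam * T w) * Real.exp (-(lam * (n * P.t n)))) :=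
        ENNReal.tsum_le_tsum markov
    _ ≤ ∑' l : L, μ.toOuterMeasure {w | w.2.2 = l} * ENNReal.ofReal P.εt := by
        rw [tsum_outcome]
        refine ENNReal.tsum_le_tsum fun l => ?_
        rw [← ENNReal.ofReal_sum_of_nonneg fun s _ => by positivity, ← Finset.sum_mul,
          ← ENNReal.ofReal_toReal (toOuterMeasure_ne_top μ _),
          ← ENNReal.ofReal_mul ENNReal.toReal_nonneg]
        refine ENNReal.ofReal_le_ofReal ?_
        calc _ ≤ prob μ {w | w.2.2 = l} * (P.εt * Real.exp (lam * (n * P.t n)))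
              * Real.exp (-(lam * (n * P.t n))) := by
              gcongr
              exact (sum_exp_totalIncrement_le hP hμ hlam hlamb l).trans
                (mul_le_mul_of_nonneg_left hexp (prob_nonneg μ _))
          _ = _ := by
              rw [mul_assoc, mul_assoc P.εt, ← Real.exp_add, add_neg_cancel, Real.exp_zero,
                mul_one]
              rfl
    _ = ENNReal.ofReal P.εt := by
        rw [ENNReal.tsum_mul_right, tsum_toOuterMeasure_fiber μ fun w => w.2.2, one_mul]

/-- The runs that satisfy the energy constraint on average and have a typical increment. -/
def goodEvent (P : ProtocolArgs) (corr energy : (i : Fin n) → History i → L → Input → ℝ) :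
    Set (Outcome n L) :=
  {w | (∀ x, (1 / (n : ℝ)) * ∑ i, energy i (past i w) w.2.2 x ≤ P.ωavg x) ∧
    totalIncrement P corr energy w ≤ n * P.t n}

theorem prob_compl_goodEvent_le (hP : P.Valid n)
    (hμ : DeviceAssumptions μ P.p P.ωpk P.ωavg P.εω corr energy) :
    prob μ (goodEvent P corr energy)ᶜ ≤ P.εω + P.εt := by
  have hsub : (goodEvent P corr energy)ᶜ ⊆
      {w | ∀ x, (1 / (n : ℝ)) * ∑ i, energy i (past i w) w.2.2 x ≤ P.ωavg x}ᶜ ∪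
        {w | n * P.t n < totalIncrement P corr energy w} := by
    intro w hw
    by_contra hc
    rw [Set.mem_union, not_or, Set.mem_compl_iff, not_not] at hc
    exact hw ⟨hc.1, not_lt.1 hc.2⟩
  have h1 := hμ.maxAverage
  have h2 := prob_lt_totalIncrement_le hP hμ
  have h3 := (prob_mono μ hsub).trans (prob_union_le μ _ _)
  rw [prob_compl, prob_compl] at h3
  rw [prob_compl]
  linarith

theorem apply_le_of_mem_goodEvent (hP : P.Valid n)
    (hμ : DeviceAssumptions μ P.p P.ωpk P.ωavg P.εω corr energy) {w : Outcome n L}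
    (hw : w ∈ goodEvent P corr energy) (hpass : w ∈ P.passEvent n L) :
    μ w ≤ marginalZ μ w.2 * ENNReal.ofReal ((2 : ℝ) ^ (-(n * (P.r - P.t n)))) := by
  rcases (ENNReal.toReal_nonneg (a := μ w)).eq_or_lt with h0 | h0
  · rw [((ENNReal.toReal_eq_zero_iff _).1 h0.symm).resolve_right (μ.apply_ne_top w)]
    exact zero_le
  have hn0 : (0 : ℝ) < n := by exact_mod_cast hP.rounds_pos
  have hform := hμ.toReal_apply_eq_marginalZ_mul w
  have hq : ∀ i, 0 ≤ roundProb corr w i := fun i =>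
    hμ.outProb_nonneg hP.p_pos i _ _ (DeviceAssumptions.pastEvent_prob_pos h0 i) _ _
  have hprod : 0 < ∏ i, roundProb corr w i := by
    refine (Finset.prod_nonneg fun i _ => hq i).lt_of_ne fun h => ?_
    rw [← h, mul_zero] at hform
    exact h0.ne' hform
  have hlog : Real.logb 2 (∏ i, roundProb corr w i) ≤ -(n * (P.r - P.t n)) := by
    rw [Real.logb_prod _ _ fun i _ h => hprod.ne' (Finset.prod_eq_zero (Finset.mem_univ i) h)]
    have h1 := hw.2
    have h2 : P.r ≤ (1 / (n : ℝ)) * ∑ i, P.xi (w.1 i) (w.2.1 i) + ∑ x, P.γ x * P.ωavg x := hpass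
    -- As `γ ≤ 0`, replacing `ω_avg` by the smaller actual average energies can only increase the
    -- score.
    have h3 : ∑ x, P.γ x * P.ωavg x
        ≤ (1 / (n : ℝ)) * ∑ i, ∑ x, P.γ x * energy i (past i w) w.2.2 x := by
      rw [Finset.sum_comm, Finset.mul_sum]
      refine Finset.sum_le_sum fun x _ => ?_
      rw [← Finset.mul_sum, mul_left_comm]
      exact mul_le_mul_of_nonpos_left (hw.1 x) (hP.tradeOff.1 x)
    have h4 := mul_le_mul_of_nonneg_left (h2.trans (add_le_add_right h3 _)) hn0.le
    rw [← mul_add, ← mul_assoc, mul_one_div_cancel hn0.ne', one_mul] at h4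
    simp only [totalIncrement, ProtocolArgs.increment, Finset.sum_add_distrib] at h1
    change _ + _ + ∑ i, Real.logb 2 (roundProb corr w i) ≤ _ at h1
    linarith
  rw [Real.logb_le_iff_le_rpow (by norm_num) hprod] at hlog
  have hZ : marginalZ μ w.2 ≠ ⊤ := PMF.apply_ne_top _ _
  rw [← ENNReal.ofReal_toReal (μ.apply_ne_top w), ← ENNReal.ofReal_toReal hZ,
    ← ENNReal.ofReal_mul ENNReal.toReal_nonneg, hform]
  exact ENNReal.ofReal_le_ofReal (mul_le_mul_of_nonneg_left hlog ENNReal.toReal_nonneg)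

end Device

/-! ### Smoothing -/

/-- A finite family can be modified off `G` so that it stays below `c` with the same total. -/
theorem exists_redistribution {A : Type*} [Fintype A] {f : A → ℝ} (G : Set A) {c : ℝ}
    (hf : ∀ a, 0 ≤ f a) (hc : 0 ≤ c) (hG : ∀ a ∈ G, f a ≤ c)
    (hsum : ∑ a, f a ≤ Fintype.card A * c) :
    ∃ ν : A → ℝ, (∀ a, 0 ≤ ν a) ∧ (∀ a, ν a ≤ c) ∧ (∀ a ∈ G, f a ≤ ν a) ∧
      ∑ a, ν a = ∑ a, f a := by
  classical
  set τ : A → ℝ := G.indicator f with hτ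
  have hτ0 : ∀ a, 0 ≤ τ a := fun a => Set.indicator_nonneg (fun a _ => hf a) a
  have hτf : ∀ a, τ a ≤ f a := fun a => Set.indicator_le_self' (fun a _ => hf a) a
  have hτc : ∀ a, τ a ≤ c := by
    intro a
    by_cases ha : a ∈ G
    · rw [hτ, Set.indicator_of_mem ha]; exact hG a ha
    · rw [hτ, Set.indicator_of_notMem ha]; exact hc
  have hTF : ∑ a, τ a ≤ ∑ a, f a := Finset.sum_le_sum fun a _ => hτf a
  set T := ∑ a, τ a
  set F := ∑ a, f a
  set N := (Fintype.card A : ℝ) * c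
  -- Every entry moves the same fraction `θ` of its distance to the ceiling, which restores the lost
  -- mass `F - T` out of the free room `N - T`.
  set θ := (F - T) / (N - T)
  have hθ0 : 0 ≤ θ := div_nonneg (by linarith) (by linarith)
  have hθ1 : θ ≤ 1 := div_le_one_of_le₀ (by linarith) (by linarith)
  refine ⟨fun a => τ a + (c - τ a) * θ, fun a => ?_, fun a => ?_, fun a ha => ?_, ?_⟩
  · exact add_nonneg (hτ0 a) (mul_nonneg (by linarith [hτc a]) hθ0)
  · nlinarith [hτc a]
  · have : τ a = f a := Set.indicator_of_mem ha f
    rw [← this]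
    exact le_add_of_nonneg_right (mul_nonneg (by linarith [hτc a]) hθ0)
  · rw [Finset.sum_add_distrib, ← Finset.sum_mul, Finset.sum_sub_distrib, Finset.sum_const,
      Finset.card_univ, nsmul_eq_mul]
    change T + (N - T) * θ = F
    -- With no free room, `T ≤ F ≤ N` forces `F = T`.
    rcases eq_or_ne (N - T) 0 with h | h
    · rw [h, zero_mul]; linarith
    · rw [mul_div_cancel₀ _ h]; ring

theorem hasSum_toReal {Ω : Type*} (μ : PMF Ω) : HasSum (fun w => (μ w).toReal) 1 := by
  have h := ENNReal.hasSum_toReal (f := μ) (by rw [μ.tsum_coe]; exact ENNReal.one_ne_top)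
  rwa [← ENNReal.tsum_toReal_eq fun w => μ.apply_ne_top w, μ.tsum_coe, ENNReal.toReal_one] at h

theorem hasSum_indicator_toReal {Ω : Type*} (μ : PMF Ω) (S : Set Ω) :
    HasSum (S.indicator fun w => (μ w).toReal) (prob μ S) := by
  have hs : Summable (S.indicator fun w => (μ w).toReal) := (hasSum_toReal μ).summable.indicator S
  have e : ∀ w, (S.indicator μ w).toReal = S.indicator (fun w => (μ w).toReal) w := by
    intro w
    by_cases hw : w ∈ S <;> simp [hw]
  rw [prob, PMF.toOuterMeasure_apply, ENNReal.tsum_toReal_eq, tsum_congr e]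
  · exact hs.hasSum
  · intro w
    exact ne_top_of_le_ne_top (μ.apply_ne_top w) (Set.indicator_le_self _ _ _)

/-- Distributions that only lose mass off `G` differ by at most the mass of `Gᶜ`. -/
theorem tvDist_le_prob_compl {Ω : Type*} {μ ν : PMF Ω} {G : Set Ω}
    (h : ∀ w ∈ G, (μ w).toReal ≤ (ν w).toReal) : tvDist ν μ ≤ prob μ Gᶜ := by
  -- `|ν - μ|` equals `ν - μ` on `G` and is at most `ν - μ + 2μ` off it; the total masses cancel.
  have hb : HasSum (fun w => (ν w).toReal - (μ w).toReal
      + 2 * Gᶜ.indicator (fun w => (μ w).toReal) w) (1 - 1 + 2 * prob μ Gᶜ) :=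
    ((hasSum_toReal ν).sub (hasSum_toReal μ)).add ((hasSum_indicator_toReal μ Gᶜ).mul_left 2)
  have hs : Summable fun w => |(ν w).toReal - (μ w).toReal| :=
    ((hasSum_toReal ν).sub (hasSum_toReal μ)).summable.abs
  have hle := hasSum_le (fun w => ?_) hs.hasSum hb
  · rw [tvDist]; linarith
  · by_cases hw : w ∈ G
    · rw [Set.indicator_of_notMem (by simpa using hw), abs_of_nonneg (by linarith [h w hw])]
      linarith
    · rw [Set.indicator_of_mem (by simpa using hw), abs_le]
      have h1 : 0 ≤ (μ w).toReal := ENNReal.toReal_nonneg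
      have h2 : 0 ≤ (ν w).toReal := ENNReal.toReal_nonneg
      constructor <;> linarith

theorem exists_smoothing {A Z : Type*} [Fintype A] (μ : PMF (A × Z)) (G : Set (A × Z))
    {c : Z → ℝ≥0∞} (hc : ∀ z, c z ≠ ⊤) (hG : ∀ w ∈ G, μ w ≤ c w.2)
    (hsum : ∀ z, marginalZ μ z ≤ Fintype.card A * c z) :
    ∃ ν : PMF (A × Z), marginalZ ν = marginalZ μ ∧ tvDist ν μ ≤ prob μ Gᶜ ∧
      ∀ a z, ν (a, z) ≤ c z := by
  have hred : ∀ z, ∃ ν : A → ℝ, (∀ a, 0 ≤ ν a) ∧ (∀ a, ν a ≤ (c z).toReal) ∧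
      (∀ a ∈ {a | (a, z) ∈ G}, (μ (a, z)).toReal ≤ ν a) ∧ ∑ a, ν a = ∑ a, (μ (a, z)).toReal := by
    intro z
    refine exists_redistribution _ (fun a => ENNReal.toReal_nonneg) ENNReal.toReal_nonneg
      (fun a ha => ENNReal.toReal_mono (hc z) (hG (a, z) ha)) ?_
    have := ENNReal.toReal_mono (ENNReal.mul_ne_top (ENNReal.natCast_ne_top _) (hc z)) (hsum z)
    rwa [marginalZ_apply, ENNReal.toReal_sum fun a _ => μ.apply_ne_top _, ENNReal.toReal_mul,
      ENNReal.toReal_natCast] at this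
  choose v hv0 hvc hvG hvs using hred
  have hfib : ∀ z, ∑ a, ENNReal.ofReal (v z a) = ∑ a, μ (a, z) := by
    intro z
    rw [← ENNReal.ofReal_sum_of_nonneg fun a _ => hv0 z a, hvs,
      ENNReal.ofReal_sum_of_nonneg fun a _ => ENNReal.toReal_nonneg]
    exact Finset.sum_congr rfl fun a _ => ENNReal.ofReal_toReal (μ.apply_ne_top _)
  have htot : ∑' w : A × Z, ENNReal.ofReal (v w.2 w.1) = 1 := by
    rw [← μ.tsum_coe, ENNReal.tsum_prod', ENNReal.tsum_prod', ENNReal.tsum_comm]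
    simp only [tsum_fintype, hfib]
    rw [Summable.tsum_finsetSum fun _ _ => ENNReal.summable]
  let ν : PMF (A × Z) := ⟨fun w => ENNReal.ofReal (v w.2 w.1), htot ▸ ENNReal.summable.hasSum⟩
  have hν : ∀ a z, ν (a, z) = ENNReal.ofReal (v z a) := fun _ _ => rfl
  refine ⟨ν, ?_, tvDist_le_prob_compl fun w hw => ?_, fun a z => ?_⟩
  · ext z
    rw [marginalZ_apply, marginalZ_apply, ← hfib]
    rfl
  · rw [show ν w = ENNReal.ofReal (v w.2 w.1) from rfl, ENNReal.toReal_ofReal (hv0 _ _)]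
    exact hvG w.2 w.1 hw
  · rw [hν]
    exact ENNReal.ofReal_le_of_le_toReal (hvc z a)

theorem condProb_le {A Z : Type*} {ν : PMF (A × Z)} {a : A} {z : Z} {C : ℝ≥0∞}
    (h : ν (a, z) ≤ C * marginalZ ν z) : condProb ν a z ≤ C :=
  ENNReal.div_le_of_le_mul h

theorem marginalZ_mul_iSup_condProb_le {A Z : Type*} {ν : PMF (A × Z)} {z : Z} {C : ℝ≥0∞}
    (h : ∀ a, ν (a, z) ≤ C) : marginalZ ν z * (⨆ a, condProb ν a z) ≤ C := by
  rw [ENNReal.mul_iSup]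
  refine iSup_le fun a => ?_
  exact ENNReal.mul_div_le.trans (h a)

/-! ### Conditioning on the test -/

section Cond

variable {Ω : Type*} {μ : PMF Ω} {S : Set Ω}

theorem toOuterMeasure_ne_zero (h : 0 < prob μ S) : μ.toOuterMeasure S ≠ 0 := by
  intro h0
  rw [prob, h0] at h
  simp at h

theorem condOn_apply_of_mem (h : 0 < prob μ S) {w : Ω} (hw : w ∈ S) :
    condOn μ S h w = μ w / μ.toOuterMeasure S := by
  rw [condOn, PMF.filter_apply, Set.indicator_of_mem hw, PMF.toOuterMeasure_apply, div_eq_mul_inv]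

theorem condOn_apply_of_notMem (h : 0 < prob μ S) {w : Ω} (hw : w ∉ S) :
    condOn μ S h w = 0 :=
  PMF.filter_apply_eq_zero_of_notMem _ hw

theorem condOn_apply_le (h : 0 < prob μ S) (w : Ω) :
    condOn μ S h w ≤ μ w / μ.toOuterMeasure S := by
  by_cases hw : w ∈ S
  · exact (condOn_apply_of_mem h hw).le
  · rw [condOn_apply_of_notMem h hw]; exact zero_le

theorem toOuterMeasure_condOn_le (h : 0 < prob μ S) (T : Set Ω) :
    (condOn μ S h).toOuterMeasure T ≤ μ.toOuterMeasure T / μ.toOuterMeasure S := by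
  rw [PMF.toOuterMeasure_apply, PMF.toOuterMeasure_apply μ T, div_eq_mul_inv,
    ← ENNReal.tsum_mul_right]
  refine ENNReal.tsum_le_tsum fun w => ?_
  by_cases hw : w ∈ T
  · rw [Set.indicator_of_mem hw, Set.indicator_of_mem hw, ← div_eq_mul_inv]
    exact condOn_apply_le h w
  · rw [Set.indicator_of_notMem hw]; exact zero_le

theorem prob_condOn_le (h : 0 < prob μ S) (T : Set Ω) :
    prob (condOn μ S h) T ≤ prob μ T / prob μ S := by
  rw [prob, prob, prob, ← ENNReal.toReal_div]
  exact ENNReal.toReal_mono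
    (ENNReal.div_ne_top (toOuterMeasure_ne_top μ T) (toOuterMeasure_ne_zero h))
    (toOuterMeasure_condOn_le h T)

theorem marginalZ_condOn_le {A Z : Type*} [Fintype A] {μ : PMF (A × Z)} {S : Set (A × Z)}
    (h : 0 < prob μ S) (z : Z) :
    marginalZ (condOn μ S h) z ≤ marginalZ μ z / μ.toOuterMeasure S := by
  rw [marginalZ_apply, marginalZ_apply, div_eq_mul_inv, Finset.sum_mul]
  exact Finset.sum_le_sum fun a _ => condOn_apply_le h (a, z)

/-- The values of `Z` whose probability is below `C` times a reference one are unlikely. -/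
theorem prob_marginalZ_lt_le {A Z : Type*} (ρ : PMF (A × Z)) (q : PMF Z) {C : ℝ} (hC : 0 ≤ C) :
    prob ρ {w | marginalZ ρ w.2 < q w.2 * ENNReal.ofReal C} ≤ C := by
  refine ENNReal.toReal_le_of_le_ofReal hC ?_
  have e : ρ.toOuterMeasure {w | marginalZ ρ w.2 < q w.2 * ENNReal.ofReal C}
      = (marginalZ ρ).toOuterMeasure {z | marginalZ ρ z < q z * ENNReal.ofReal C} := by
    rw [marginalZ, PMF.toOuterMeasure_map_apply]
    rfl
  rw [e, PMF.toOuterMeasure_apply]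
  calc _ ≤ ∑' z, q z * ENNReal.ofReal C := by
        refine ENNReal.tsum_le_tsum fun z => ?_
        by_cases hz : marginalZ ρ z < q z * ENNReal.ofReal C
        · rw [Set.indicator_of_mem (by exact hz)]; exact hz.le
        · rw [Set.indicator_of_notMem (by exact hz)]; exact zero_le
    _ = ENNReal.ofReal C := by rw [ENNReal.tsum_mul_right, q.tsum_coe, one_mul]

end Cond

/-- The room for smoothing: `2^n` output strings, each allowed conditional weight `2^{-ns}`, can
carry a full distribution. -/
theorem one_le_card_mul_rpow {n : ℕ} {s : ℝ} (hs : s ≤ 1) :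
    1 ≤ (Fintype.card (Fin n → Output) : ℝ≥0∞) * ENNReal.ofReal ((2 : ℝ) ^ (-(n * s))) := by
  have hcard : Fintype.card (Fin n → Output) = 2 ^ n := by
    rw [Fintype.card_fun, Fintype.card_units_int, Fintype.card_fin]
  rw [hcard, ← ENNReal.ofReal_natCast, ← ENNReal.ofReal_mul (Nat.cast_nonneg _),
    ← ENNReal.ofReal_one]
  refine ENNReal.ofReal_le_ofReal ?_
  rw [Nat.cast_pow, Nat.cast_ofNat, ← Real.rpow_natCast, ← Real.rpow_add two_pos]
  refine Real.one_le_rpow one_le_two ?_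
  nlinarith [(Nat.cast_nonneg n : (0 : ℝ) ≤ n)]

theorem rpow_neg_sub_logb {s c : ℝ} (hc : 0 < c) :
    (2 : ℝ) ^ (-(s - Real.logb 2 (1 / c))) = (2 : ℝ) ^ (-s) / c := by
  rw [neg_sub, sub_eq_add_neg, Real.rpow_add two_pos,
    Real.rpow_logb two_pos (by norm_num) (by positivity)]
  ring

/-! ### The entropy bounds -/

section Main

variable {n : ℕ} {L : Type*} {P : ProtocolArgs} {μ : PMF (Outcome n L)}
  {corr energy : (i : Fin n) → History i → L → Input → ℝ}

theorem condOn_apply_le_of_mem_goodEvent (hP : P.Valid n)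
    (hμ : DeviceAssumptions μ P.p P.ωpk P.ωavg P.εω corr energy)
    (hpos : 0 < prob μ (P.passEvent n L)) {w : Outcome n L} (hw : w ∈ goodEvent P corr energy) :
    condOn μ (P.passEvent n L) hpos w ≤
      marginalZ μ w.2 * ENNReal.ofReal ((2 : ℝ) ^ (-(n * (P.r - P.t n))))
        / μ.toOuterMeasure (P.passEvent n L) := by
  by_cases hp : w ∈ P.passEvent n L
  · rw [condOn_apply_of_mem hpos hp]
    exact ENNReal.div_le_div_right (apply_le_of_mem_goodEvent hP hμ hw hp) _
  · rw [condOn_apply_of_notMem hpos hp]; exact zero_le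

theorem mem_avgAchievable (hP : P.Valid n)
    (hμ : DeviceAssumptions μ P.p P.ωpk P.ωavg P.εω corr energy)
    (hpos : 0 < prob μ (P.passEvent n L)) :
    n * (P.r - P.t n) - Real.logb 2 (1 / prob μ (P.passEvent n L)) ∈
      avgAchievable ((P.εω + P.εt) / prob μ (P.passEvent n L))
        (condOn μ (P.passEvent n L) hpos) := by
  set S := P.passEvent n L
  set T := ENNReal.ofReal ((2 : ℝ) ^ (-(n * (P.r - P.t n))))
  have hS0 := toOuterMeasure_ne_zero hpos
  have hmZ : ∀ z, marginalZ μ z ≠ ⊤ := fun z => PMF.apply_ne_top _ z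
  obtain ⟨ν, hνZ, hνtv, hνc⟩ := exists_smoothing (condOn μ S hpos) (goodEvent P corr energy)
    -- The unconditioned marginal is kept in the ceiling: the average entropy only sums it over `z`,
    -- to `T/κ`.
    (c := fun z => marginalZ μ z * T / μ.toOuterMeasure S)
    (fun z => ENNReal.div_ne_top (ENNReal.mul_ne_top (hmZ z) ENNReal.ofReal_ne_top) hS0)
    (fun w hw => condOn_apply_le_of_mem_goodEvent hP hμ hpos hw)
    (fun z => by
      refine (marginalZ_condOn_le hpos z).trans ?_
      rw [← mul_div_assoc, mul_left_comm]
      exact ENNReal.div_le_div_right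
        (le_mul_of_one_le_right zero_le (one_le_card_mul_rpow hP.r_sub_t_le_one)) _)
  refine ⟨ν, hνZ, hνtv.trans ((prob_condOn_le hpos _).trans ?_), ?_⟩
  · exact div_le_div_of_nonneg_right (prob_compl_goodEvent_le hP hμ) hpos.le
  · calc ∑' z, marginalZ ν z * (⨆ a, condProb ν a z)
        ≤ ∑' z, marginalZ μ z * (T / μ.toOuterMeasure S) :=
          ENNReal.tsum_le_tsum fun z =>
            marginalZ_mul_iSup_condProb_le fun a => (hνc a z).trans_eq (mul_div_assoc _ _ _)
      _ = T / μ.toOuterMeasure S := by rw [ENNReal.tsum_mul_right, PMF.tsum_coe, one_mul]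
      _ = _ := by
          rw [rpow_neg_sub_logb hpos, ENNReal.ofReal_div_of_pos hpos, prob,
            ENNReal.ofReal_toReal (toOuterMeasure_ne_top μ S)]

theorem mem_worstAchievable (hP : P.Valid n)
    (hμ : DeviceAssumptions μ P.p P.ωpk P.ωavg P.εω corr energy)
    (hpos : 0 < prob μ (P.passEvent n L)) :
    n * (P.r - P.t n) - Real.logb 2 (1 / P.εm) ∈
      worstAchievable ((P.εω + P.εt + P.εm) / prob μ (P.passEvent n L))
        (condOn μ (P.passEvent n L) hpos) := by
  set S := P.passEvent n L
  set T := ENNReal.ofReal ((2 : ℝ) ^ (-(n * (P.r - P.t n))))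
  set ρ := condOn μ S hpos
  have hεm := hP.εm_pos
  have hεm0 : ENNReal.ofReal P.εm ≠ 0 := (ENNReal.ofReal_pos.2 hεm).ne'
  have hS : ENNReal.ofReal (prob μ S) = μ.toOuterMeasure S :=
    ENNReal.ofReal_toReal (toOuterMeasure_ne_top μ S)
  have hmZ : ∀ z, marginalZ ρ z ≠ ⊤ := fun z => PMF.apply_ne_top _ z
  -- Off `B`, `μ(z)/κ ≤ μ_Pass(z)/ε_m`, which turns the ceiling of the average case into one
  -- proportional to `μ_Pass(z)`.
  set B : Set (Outcome n L) :=
    {w | marginalZ ρ w.2 < marginalZ μ w.2 * ENNReal.ofReal (P.εm / prob μ S)}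
  have hC : T / ENNReal.ofReal P.εm ≠ ⊤ := ENNReal.div_ne_top ENNReal.ofReal_ne_top hεm0
  obtain ⟨ν, hνZ, hνtv, hνc⟩ := exists_smoothing ρ (goodEvent P corr energy \ B)
    (c := fun z => T / ENNReal.ofReal P.εm * marginalZ ρ z)
    (fun z => ENNReal.mul_ne_top hC (hmZ z))
    (fun w hw => by
      refine (condOn_apply_le_of_mem_goodEvent hP hμ hpos hw.1).trans ?_
      have hB : marginalZ μ w.2 * ENNReal.ofReal (P.εm / prob μ S) ≤ marginalZ ρ w.2 :=
        not_lt.1 hw.2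
      calc _ = T / ENNReal.ofReal P.εm
            * (marginalZ μ w.2 * ENNReal.ofReal (P.εm / prob μ S)) := by
            rw [ENNReal.ofReal_div_of_pos hpos, hS, mul_left_comm, ← mul_div_assoc,
              ENNReal.div_mul_cancel hεm0 ENNReal.ofReal_ne_top, mul_div_assoc]
        _ ≤ _ := by gcongr)
    (fun z => by
      rw [← mul_assoc, ← mul_div_assoc]
      refine le_mul_of_one_le_left zero_le ?_
      rw [ENNReal.le_div_iff_mul_le (Or.inl hεm0) (Or.inl ENNReal.ofReal_ne_top), one_mul]
      exact (ENNReal.ofReal_le_one.2 hP.εm_le_one).trans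
        (one_le_card_mul_rpow hP.r_sub_t_le_one))
  refine ⟨ν, hνZ, hνtv.trans ?_, fun a z => ?_⟩
  · have hsub : (goodEvent P corr energy \ B)ᶜ ⊆ (goodEvent P corr energy)ᶜ ∪ B := by
      rw [Set.sdiff_eq, Set.compl_inter, compl_compl]
    refine (prob_mono ρ hsub).trans ((prob_union_le ρ _ _).trans ?_)
    rw [add_div]
    refine add_le_add ((prob_condOn_le hpos _).trans ?_)
      (prob_marginalZ_lt_le ρ _ (div_pos hεm hpos).le)
    exact div_le_div_of_nonneg_right (prob_compl_goodEvent_le hP hμ) hpos.le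
  · rw [rpow_neg_sub_logb hεm, ENNReal.ofReal_div_of_pos hεm]
    refine condProb_le ?_
    rw [hνZ]
    exact hνc a z

end Main

theorem ProtocolArgs.sigmaH_eq (P : ProtocolArgs) {n : ℕ} (hn : 1 ≤ n) :
    n * (P.r - P.t n) - Real.logb 2 (1 / P.εm) = P.sigmaH n := by
  have hn0 : (n : ℝ) ≠ 0 := by exact_mod_cast (Nat.one_le_iff_ne_zero.1 hn)
  rw [ProtocolArgs.sigmaH, ProtocolArgs.t, mul_sub (n : ℝ) _ (Real.logb 2 (1 / P.εm) / n),
    mul_div_cancel₀ _ hn0]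
  ring

end SemiDI

end

theorem proposition6 {n : ℕ} {L : Type*} (P : SemiDI.ProtocolArgs) (hP : P.Valid n)
    (μ : PMF (SemiDI.Outcome n L))
    (corr energy : (i : Fin n) → SemiDI.History i → L → SemiDI.Input → ℝ)
    (hμ : SemiDI.DeviceAssumptions μ P.p P.ωpk P.ωavg P.εω corr energy)
    (κ : ℝ) (hκ : κ = SemiDI.prob μ (P.passEvent n L))
    (hpos : 0 < SemiDI.prob μ (P.passEvent n L)) :
    -- smooth average conditional min-entropy
    (n * (P.r - P.t n) - Real.logb 2 (1 / κ) ∈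
        SemiDI.avgAchievable ((P.εω + P.εt) / κ) (SemiDI.condOn μ (P.passEvent n L) hpos) ∧
      ((n * (P.r - P.t n) - Real.logb 2 (1 / κ) : ℝ) : EReal) ≤
        SemiDI.smoothAvgMinEntropy ((P.εω + P.εt) / κ)
          (SemiDI.condOn μ (P.passEvent n L) hpos)) ∧
    -- smooth worst-case conditional min-entropy
    (n * (P.r - P.t n) - Real.logb 2 (1 / P.εm) ∈
        SemiDI.worstAchievable ((P.εω + P.εt + P.εm) / κ)
          (SemiDI.condOn μ (P.passEvent n L) hpos) ∧
      ((n * (P.r - P.t n) - Real.logb 2 (1 / P.εm) : ℝ) : EReal) ≤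
        SemiDI.smoothWorstMinEntropy ((P.εω + P.εt + P.εm) / κ)
          (SemiDI.condOn μ (P.passEvent n L) hpos)) ∧
    n * (P.r - P.t n) - Real.logb 2 (1 / P.εm) = P.sigmaH n := by
  subst hκ
  have havg := SemiDI.mem_avgAchievable hP hμ hpos
  have hworst := SemiDI.mem_worstAchievable hP hμ hpos
  exact ⟨⟨havg, le_sSup ⟨_, havg, rfl⟩⟩, ⟨hworst, le_sSup ⟨_, hworst, rfl⟩⟩,
    P.sigmaH_eq hP.rounds_pos⟩
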